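/- Let $n\ge 4$ and let $\mathbb{C}\langle n^2\rangle$ be the free associative algebra over $\mathbb{C}$ on the $n^2$ symbols $u_{ij}$, $1\le i,j\le n$. Put $$\mathsf{rs}_i=\sum_{\alpha=1}^n u_{i\alpha}-1,\quad \mathsf{cs}_i=\sum_{\alpha=1}^n u_{\alpha i}-1,\quad \mathsf{ip}_{ij}=u_{ij}^2-u_{ij},$$ and, for $j\neq k$, $\mathsf{inj}_{jik}=u_{ji}u_{ki}$ and $\mathsf{wel}_{ijk}=u_{ij}u_{ik}$. Let $I_n$ be the two-sided ideal generated by all $\mathsf{rs}_i,\mathsf{cs}_i,\mathsf{ip}_{ij}$ $(1\le i,j\le n)$ and all $\mathsf{inj}_{jik},\mathsf{wel}_{ijk}$ $(1\le i,j,k\le n,\ j\ne k)$. For $2\le j,k\le n$ with $j\ne k$ put $$\mathsf{rinj}_{jk}=\sum_{\alpha=3}^n u_{j2}u_{k\alpha}-\sum_{\alpha=3}^n u_{j\alpha}u_{k1}+u_{k1}-u_{j2},\qquad \mathsf{rwel}_{jk}=\sum_{\alpha=3}^n u_{2j}u_{\alpha k}-\sum_{\alpha=3}^n u_{\alpha j}u_{1k}+u_{1k}-u_{2j}.$$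 Order monomials (words) by the degree-lexicographic order with $u_{11}>u_{12}>\dots>u_{1n}>u_{21}>\dots>u_{nn}$: words are compared first by length, then lexicographically from the left. A word $v$ divides a word $w$ if $w=avb$ for some words $a,b$. A set $G\subseteq I_n$ is a Gröbner basis of $I_n$ if for every nonzero $f\in I_n$ there is a nonzero $g\in G$ whose leading monomial divides that of $f$. A set of nonzero polynomials is monic if all its elements have leading coefficient $1$, and reduced if no leading monomial of one of its elements divides the leading monomial of a different element. **Theorem.** For every $n\ge 4$, the union $G_n$ of the following sets is a finite, monic and reduced Gröbner basis of $I_n$: 1. $\{\mathsf{cs}_1\}$ and all $\mathsf{cs}_i,\mathsf{rs}_i$ with $2\le i\le n$; 2. all $\mathsf{ip}_{ij}$ with $2\le i,j\le n$; 3. all $\mathsf{inj}_{ijk}$ with $2\le i,j,k\le n$, $i\neq k$, and all $\mathsf{wel}_{ijk}$ with $2\le i,j,k\le n$, $j\ne k$; 4. all $\mathsf{rinj}_{kj}$ with $2\le k,j\le n$, $k\ne j$, and all $\mathsf{rwel}_{kj}$ with $2\le k,j\le n$, $k\neq j$, $(k,j)\neq(2,3)$; 5. all $\mathsf{rinj}_{kj}\,u_{i3}-u_{k2}\,\mathsf{inj}_{j3i}$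 with $2\le i,j,k\le n$, $k\ne j\neq i$, $(k,j)\ne(2,3)$ and $(j,i)\neq(2,3)$; 6. all $\mathsf{rwel}_{kj}\,u_{3i}-u_{2k}\,\mathsf{wel}_{3ji}$ with $2\le i,j,k\le n$, $k\ne j\ne i$, $(k,j)\ne(2,3)$, $(j,i)\neq(2,3)$ and $(k,j,i)\ne(2,4,3)$. Its cardinality is $\#G_n=4n^3-15n^2+16n-2$. -/

import Mathlib

noncomputable section

namespace QuantumSym

/-! ## Degree-lexicographic order and Gröbner bases in free associative algebras -/

section Order

variable {n : ℕ}

/-- The free associative algebra `ℂ⟨n²⟩` on the symbols `u_{ij}`, `i, j ∈ Fin n`. -/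
abbrev Alg (n : ℕ) : Type := FreeAlgebra ℂ (Fin n × Fin n)

/-- Monomials: words in the symbols `u_{ij}` (with coefficient one). -/
abbrev Word (n : ℕ) : Type := FreeMonoid (Fin n × Fin n)

/-- The row-wise order of the variables, `u_{11} > u_{12} > ⋯ > u_{1n} > u_{21} > ⋯ > u_{nn}`:
`varLT p q` means `u_p < u_q`, i.e. `p` comes strictly after `q` when reading row by row. -/
def varLT (p q : Fin n × Fin n) : Prop :=
  q.1 < p.1 ∨ (q.1 = p.1 ∧ q.2 < p.2)

/-- The degree-lexicographic order on words: compare lengths first and break ties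
lexicographically from the left, using the row-wise order of the variables. -/
def wordLT (v w : Word n) : Prop :=
  List.Shortlex varLT v.toList w.toList

/-- The coefficient of the monomial `w` in the noncommutative polynomial `f`. -/
def coeff (f : Alg n) (w : Word n) : ℂ :=
  (FreeAlgebra.equivMonoidAlgebraFreeMonoid f).coeff w

/-- `w` is the leading monomial of `f`: it occurs in `f`, and every other monomial that occurs
in `f` is smaller. (The zero polynomial has no leading monomial.) -/
def IsLeadingMonomial (f : Alg n) (w : Word n) : Prop :=
  coeff f w ≠ 0 ∧ ∀ v : Word n, coeff f v ≠ 0 → v ≠ w → wordLT v w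

/-- The monomial `v` divides the monomial `w`: `w = a v b` for some monomials `a`, `b`. -/
def WordDvd (v w : Word n) : Prop :=
  ∃ a b : Word n, w = a * v * b

/-- `G` is a (noncommutative) Gröbner basis of the two-sided ideal `I`: it is contained in `I`, and
the leading monomial of every nonzero element of `I` is divisible by that of some element
of `G`. -/
def IsGroebnerBasis (G : Set (Alg n)) (I : TwoSidedIdeal (Alg n)) : Prop :=
  (∀ g ∈ G, g ∈ I) ∧
    ∀ f ∈ I, f ≠ 0 → ∃ g ∈ G, ∃ v w : Word n,
      IsLeadingMonomial g v ∧ IsLeadingMonomial f w ∧ WordDvd v w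

/-- All elements of `G` are nonzero with leading coefficient one. -/
def IsMonic (G : Set (Alg n)) : Prop :=
  ∀ g ∈ G, ∃ w : Word n, IsLeadingMonomial g w ∧ coeff g w = 1

/-- No leading monomial of an element of `G` divides that of another element of `G`. -/
def IsReduced (G : Set (Alg n)) : Prop :=
  ∀ f ∈ G, ∀ g ∈ G, f ≠ g → ∀ v w : Word n,
    IsLeadingMonomial f v → IsLeadingMonomial g w → ¬ WordDvd v w

end Order

/-! ## Quantum symmetry relations -/

section Relations

variable {n : ℕ}

/-- The symbol `u_{ij}`. -/
def u (i j : Fin n) : Alg n := FreeAlgebra.ι ℂ (i, j)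

/-- Row sum relation `∑_α u_{iα} - 1`. -/
def rs (i : Fin n) : Alg n := ∑ α : Fin n, u i α - 1

/-- Column sum relation `∑_α u_{αi} - 1`. -/
def cs (i : Fin n) : Alg n := ∑ α : Fin n, u α i - 1

/-- Idempotent relation `u_{ij}² - u_{ij}`. -/
def ip (i j : Fin n) : Alg n := u i j ^ 2 - u i j

/-- Orthogonal relation `inj_{jik} = u_{ji} u_{ki}` (used for `j ≠ k`). -/
def inj (j i k : Fin n) : Alg n := u j i * u k i

/-- Orthogonal relation `wel_{ijk} = u_{ij} u_{ik}` (used for `j ≠ k`). -/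
def wel (i j k : Fin n) : Alg n := u i j * u i k

variable (n) in
/-- The two-sided ideal `I_n` of quantum symmetries. -/
def idealI : TwoSidedIdeal (Alg n) :=
  TwoSidedIdeal.span
    ({f | ∃ i : Fin n, f = rs i} ∪ {f | ∃ i : Fin n, f = cs i} ∪
      {f | ∃ i j : Fin n, f = ip i j} ∪
      {f | ∃ i j k : Fin n, j ≠ k ∧ f = inj j i k} ∪
      {f | ∃ i j k : Fin n, j ≠ k ∧ f = wel i j k})

variable (hn : 4 ≤ n)

/-- The first index (the index `1` of `{1, …, n}`). -/
def i1 : Fin n := ⟨0, by omega⟩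
/-- The second index (the index `2` of `{1, …, n}`). -/
def i2 : Fin n := ⟨1, by omega⟩
/-- The third index (the index `3` of `{1, …, n}`). -/
def i3 : Fin n := ⟨2, by omega⟩
/-- The fourth index (the index `4` of `{1, …, n}`). -/
def i4 : Fin n := ⟨3, by omega⟩

/-- Reduced orthogonal relation
`rinj_{jk} = ∑_{α ≥ 3} u_{j2} u_{kα} - ∑_{α ≥ 3} u_{jα} u_{k1} + u_{k1} - u_{j2}`. -/
def rinj (j k : Fin n) : Alg n :=
  (∑ α : Fin n with i3 hn ≤ α, u j (i2 hn) * u k α)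
    - (∑ α : Fin n with i3 hn ≤ α, u j α * u k (i1 hn))
    + u k (i1 hn) - u j (i2 hn)

/-- Reduced orthogonal relation
`rwel_{jk} = ∑_{α ≥ 3} u_{2j} u_{αk} - ∑_{α ≥ 3} u_{αj} u_{1k} + u_{1k} - u_{2j}`. -/
def rwel (j k : Fin n) : Alg n :=
  (∑ α : Fin n with i3 hn ≤ α, u (i2 hn) j * u α k)
    - (∑ α : Fin n with i3 hn ≤ α, u α j * u (i1 hn) k)
    + u (i1 hn) k - u (i2 hn) j

/-- Overlap relation of `inj` and `rinj`, with the sign that makes it monic: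
`rinj_{kj} u_{i3} - u_{k2} inj_{j3i}`. -/
def bgInj (k j i : Fin n) : Alg n :=
  rinj hn k j * u i (i3 hn) - u k (i2 hn) * inj j (i3 hn) i

/-- Overlap relation of `wel` and `rwel`, with the sign that makes it monic:
`rwel_{kj} u_{3i} - u_{2k} wel_{3ji}`. -/
def bgWel (k j i : Fin n) : Alg n :=
  rwel hn k j * u (i3 hn) i - u (i2 hn) k * wel (i3 hn) j i

/-- The part of `G_n` of degree at most two: `cs_1` and all `cs_i`, `rs_i`, `ip_{ij}`, `inj_{ijk}`
(`i ≠ k`), `wel_{ijk}` (`j ≠ k`), `rinj_{kj}` (`k ≠ j`), `rwel_{kj}` (`k ≠ j` and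
`(k, j) ≠ (2, 3)`) whose indices differ from `1`. -/
def setF : Set (Alg n) :=
  {cs (i1 hn)} ∪
  {f | ∃ i, i ≠ i1 hn ∧ f = cs i} ∪
  {f | ∃ i, i ≠ i1 hn ∧ f = rs i} ∪
  {f | ∃ i j, i ≠ i1 hn ∧ j ≠ i1 hn ∧ f = ip i j} ∪
  {f | ∃ i j k, i ≠ i1 hn ∧ j ≠ i1 hn ∧ k ≠ i1 hn ∧ i ≠ k ∧ f = inj i j k} ∪
  {f | ∃ i j k, i ≠ i1 hn ∧ j ≠ i1 hn ∧ k ≠ i1 hn ∧ j ≠ k ∧ f = wel i j k} ∪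
  {f | ∃ k j, k ≠ i1 hn ∧ j ≠ i1 hn ∧ k ≠ j ∧ f = rinj hn k j} ∪
  {f | ∃ k j, k ≠ i1 hn ∧ j ≠ i1 hn ∧ k ≠ j ∧ (k, j) ≠ (i2 hn, i3 hn) ∧ f = rwel hn k j}

/-- The first family of degree-three relations in `G_n`. -/
def setBInj : Set (Alg n) :=
  {f | ∃ k j i, k ≠ i1 hn ∧ j ≠ i1 hn ∧ i ≠ i1 hn ∧ k ≠ j ∧ j ≠ i ∧
    (k, j) ≠ (i2 hn, i3 hn) ∧ (j, i) ≠ (i2 hn, i3 hn) ∧ f = bgInj hn k j i}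

/-- The second family of degree-three relations in `G_n`. -/
def setBWel : Set (Alg n) :=
  {f | ∃ k j i, k ≠ i1 hn ∧ j ≠ i1 hn ∧ i ≠ i1 hn ∧ k ≠ j ∧ j ≠ i ∧
    (k, j) ≠ (i2 hn, i3 hn) ∧ (j, i) ≠ (i2 hn, i3 hn) ∧
    (k, j, i) ≠ (i2 hn, i4 hn, i3 hn) ∧ f = bgWel hn k j i}

/-- The Gröbner basis `G_n`. -/
def setG : Set (Alg n) := setF hn ∪ setBInj hn ∪ setBWel hn

end Relations

end QuantumSym

end

/-!
Write `W_k` for the set of words of length `k` in the letters `2, …, n` which have no two equal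
adjacent letters and contain neither `23` nor `243` as a factor. The leading monomials of `G_n` are
arranged so that a word `u_{i₁j₁} ⋯ u_{i_kj_k}` avoids all of them exactly when its word of rows
`i₁ ⋯ i_k` and its word of columns `j₁ ⋯ j_k` both lie in `W_k` (`exists_isLM_infix` is the half
needed here). As `G_n` lies in `I_n` and is monic, rewriting shows that these normal words span the
quotient by `I_n`, and the Gröbner basis property amounts to their linear independence modulo `I_n`.

Instead of resolving overlaps, independence is read off a representation. Consider the graded
algebra `R = ℂ⟨e_1, …, e_n⟩ / (∑ e_i, e_i²)`. The normal words `W_k` are a basis of its degree-`k`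
part `R_k`; linear independence follows from an explicit action of `R` on combinations of normal
words (`letter`), in which `e_2` is defined recursively and `e_2² = 0` is deduced from the identity
`s² = e_2²` for the sum `s` of the letters `2, …, n` (`letterSum_letterSum`).

On `R_k` there are, for each `i`, idempotents `p_i` with kernel `e_i R_{k-1}`, and lowering
operators `G_i : R_{k+1} → R_k` with `G_i e_i = p_i`, `e_i G_i = 1 - p_i`, and
`G_i e_j = -r_k p_i p_j` for `i ≠ j`, where `r_0 = 1 / (n - 1)` and `r_{k+1} = 1 / (n - 2 - r_k)`.
Here `n ≥ 4` enters: it keeps `0 < r_k ≤ 1`. The spaces are built degree by degree (`Stage.next`),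
`R_{k+1}` being the quotient of `n` copies of `R_k` by the constant families and the kernels of the
`p_i`; the identity `r_k ∑ p_i = (r_k + 1)` is what makes the lowering operators well defined.

On the product over `k` of `R_k ⊗ R_k` the operators
`u_{ij} = e_i ⊗ e_j + (a_k e_i G_i ⊗ e_j G_j + b_k p_i ⊗ p_j) + a_k b_k G_i ⊗ G_j`, for suitable
scalars, satisfy all the relations of `I_n` (`magic_mul_self`, `magic_mul_row`, `magic_mul_col`,
`sum_magic_row`, `sum_magic_col`), because they factor as `up ∘ down`. A word of length `k`, applied
to the vacuum `1 ⊗ 1`, has top component `e_{i₁} ⋯ e_{i_k} ⊗ e_{j₁} ⋯ e_{j_k}` in degree `k`. Hence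
normal words of length `k` have linearly independent top components, and no nonzero element of `I_n`
has a normal leading monomial (`not_isNormalWord_of_isLeadingMonomial`).

That `G_n` is monic, reduced, and of the stated cardinality is a matter of its leading monomials:
they form a set of words (`IsLM`) none of which is a factor of another, and `G_n` is the image of
that set under an injective map (`poly`).
-/

noncomputable section

namespace QuantumSym

open TensorProduct

/-! ### Monomials and leading monomials -/

section Monomials

variable {n : ℕ}

/-- The monomial `u_{i₁j₁} ⋯ u_{i_kj_k}` attached to the list of its index pairs. -/
def mon (l : List (Fin n × Fin n)) : Alg n := (l.map (FreeAlgebra.ι ℂ)).prod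

@[simp] lemma mon_nil : mon ([] : List (Fin n × Fin n)) = 1 := rfl

lemma mon_cons (a : Fin n × Fin n) (l : List (Fin n × Fin n)) :
    mon (a :: l) = u a.1 a.2 * mon l := by
  simp [mon, u]

lemma mon_append (l l' : List (Fin n × Fin n)) : mon (l ++ l') = mon l * mon l' := by
  simp [mon]

lemma u_eq_mon (i j : Fin n) : u i j = mon [(i, j)] := by simp [mon, u]

lemma equiv_mon (l : List (Fin n × Fin n)) :
    FreeAlgebra.equivMonoidAlgebraFreeMonoid (mon l) =
      MonoidAlgebra.of ℂ (Word n) (FreeMonoid.ofList l) := by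
  induction l with
  | nil => rw [mon_nil, map_one, FreeMonoid.ofList_nil, map_one]
  | cons a l ih =>
    have h : FreeAlgebra.equivMonoidAlgebraFreeMonoid (FreeAlgebra.ι ℂ a) =
        MonoidAlgebra.of ℂ (Word n) (FreeMonoid.of a) := by
      simp [FreeAlgebra.equivMonoidAlgebraFreeMonoid]
    rw [mon_cons, map_mul, ih, FreeMonoid.ofList_cons, map_mul, u, h]

/-- The coefficient of a fixed monomial, as a linear functional. -/
def coeffLin (w : Word n) : Alg n →ₗ[ℂ] ℂ where
  toFun f := coeff f w
  map_add' f g := by simp [coeff]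
  map_smul' c f := by simp [coeff]

lemma coeffLin_apply (w : Word n) (f : Alg n) : coeffLin w f = coeff f w := rfl

lemma coeff_mon (l : List (Fin n × Fin n)) (w : Word n) [Decidable (FreeMonoid.ofList l = w)] :
    coeff (mon l) w = if FreeMonoid.ofList l = w then 1 else 0 := by
  rw [coeff, equiv_mon, MonoidAlgebra.of_apply, MonoidAlgebra.coeff_single, Finsupp.single_apply]

lemma eq_sum_coeff (f : Alg n) :
    f = ∑ w ∈ (FreeAlgebra.equivMonoidAlgebraFreeMonoid f).coeff.support,
      coeff f w • mon w.toList := by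
  apply FreeAlgebra.equivMonoidAlgebraFreeMonoid.injective
  simp only [map_sum, map_smul, equiv_mon, FreeMonoid.ofList_toList]
  generalize h : FreeAlgebra.equivMonoidAlgebraFreeMonoid f = g
  simp only [coeff, h]
  conv_lhs => rw [← MonoidAlgebra.sum_coeff_single g]
  simp [Finsupp.sum]

lemma mem_of_mon_mem {K : Submodule ℂ (Alg n)} {f : Alg n}
    (h : ∀ w, coeff f w ≠ 0 → mon w.toList ∈ K) : f ∈ K := by
  rw [eq_sum_coeff f]
  refine K.sum_mem fun w hw => K.smul_mem _ (h w ?_)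
  simpa [coeff] using hw

instance : Std.Asymm (varLT (n := n)) :=
  ⟨fun p q h h' => by simp only [varLT] at h h'; omega⟩

instance : IsTrans (Fin n × Fin n) varLT :=
  ⟨fun p q r h h' => by simp only [varLT] at h h' ⊢; omega⟩

instance : Std.Trichotomous (varLT (n := n)) :=
  ⟨fun p q h h' => by simp only [varLT] at h h'; ext <;> omega⟩

lemma wellFounded_varLT : WellFounded (varLT (n := n)) :=
  Finite.wellFounded_of_trans_of_irrefl _

instance : IsTrans (List (Fin n × Fin n)) (List.Shortlex varLT) :=
  ⟨fun a b c h h' => by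
    rw [List.shortlex_def] at h h' ⊢
    rcases h with h | ⟨h, hlex⟩ <;> rcases h' with h' | ⟨h', hlex'⟩
    · exact Or.inl (h.trans h')
    · exact Or.inl (h.trans_eq h')
    · exact Or.inl (h.trans_lt h')
    · exact Or.inr ⟨h.trans h', List.lex_trans (fun h h' => _root_.trans h h') hlex hlex'⟩⟩

/-- The span of the monomials smaller than `l` in the degree-lexicographic order. -/
def below (l : List (Fin n × Fin n)) : Submodule ℂ (Alg n) :=
  Submodule.span ℂ (mon '' {v | List.Shortlex varLT v l})

lemma mon_mem_below {v l : List (Fin n × Fin n)} (h : List.Shortlex varLT v l) :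
    mon v ∈ below l := Submodule.subset_span ⟨v, h, rfl⟩

lemma mon_mem_below_of_length {v l : List (Fin n × Fin n)} (h : v.length < l.length) :
    mon v ∈ below l := mon_mem_below (.of_length_lt h)

lemma coeff_eq_zero_of_mem_below {f : Alg n} {l : List (Fin n × Fin n)} (hf : f ∈ below l)
    {w : Word n} (hw : ¬ List.Shortlex varLT w.toList l) : coeff f w = 0 := by
  classical
  suffices h : below l ≤ LinearMap.ker (coeffLin w) from h hf
  refine Submodule.span_le.2 ?_
  rintro _ ⟨v, hv, rfl⟩
  have : FreeMonoid.ofList v ≠ w := by rintro rfl; exact hw hv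
  simp [coeffLin_apply, coeff_mon, this]

lemma isLeadingMonomial_of_sub_mem_below {f : Alg n} {l : List (Fin n × Fin n)}
    (h : f - mon l ∈ below l) :
    IsLeadingMonomial f (FreeMonoid.ofList l) ∧ coeff f (FreeMonoid.ofList l) = 1 := by
  classical
  have hc : ∀ w, coeff f w = coeff (mon l) w + coeff (f - mon l) w := fun w => by
    simp only [← coeffLin_apply, map_sub]; ring
  have hl : coeff f (FreeMonoid.ofList l) = 1 := by
    rw [hc, coeff_eq_zero_of_mem_below (w := FreeMonoid.ofList l) h (Std.Irrefl.irrefl l),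
      coeff_mon]
    simp
  refine ⟨⟨by simp [hl], fun v hv hvl => ?_⟩, hl⟩
  by_contra hlt
  refine hv ?_
  rw [hc, coeff_eq_zero_of_mem_below h hlt, coeff_mon, if_neg hvl.symm, add_zero]

lemma exists_isLeadingMonomial {f : Alg n} (hf : f ≠ 0) : ∃ w, IsLeadingMonomial f w := by
  let s := (FreeAlgebra.equivMonoidAlgebraFreeMonoid f).coeff.support
  have hs : ∀ w, w ∈ s ↔ coeff f w ≠ 0 := fun w => by simp [s, coeff]
  have hne : s.Nonempty := by
    rw [Finset.nonempty_iff_ne_empty]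
    intro h
    refine hf ?_
    rw [eq_sum_coeff f]
    exact Finset.sum_eq_zero fun w hw => absurd (show w ∈ s from hw) (by simp [h])
  let r : s → s → Prop := fun v w => List.Shortlex varLT w.1.toList v.1.toList
  have : IsTrans s r := ⟨fun a b c h h' => _root_.trans (r := List.Shortlex varLT) h' h⟩
  have : Std.Irrefl r := ⟨fun a => Std.Irrefl.irrefl (r := List.Shortlex varLT) a.1.toList⟩
  obtain ⟨w, -, hw⟩ := (Finite.wellFounded_of_trans_of_irrefl r).has_min Set.univ
    ⟨⟨hne.choose, hne.choose_spec⟩, trivial⟩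
  refine ⟨w.1, (hs _).1 w.2, fun v hv hvw => ?_⟩
  by_contra h
  exact hvw (FreeMonoid.toList.injective
    (Std.Trichotomous.trichotomous (r := List.Shortlex varLT) _ _ h (hw ⟨v, (hs v).2 hv⟩ trivial)))

lemma IsLeadingMonomial.unique {f : Alg n} {v w : Word n} (hv : IsLeadingMonomial f v)
    (hw : IsLeadingMonomial f w) : v = w := by
  by_contra h
  exact Std.Asymm.asymm (r := List.Shortlex (varLT (n := n))) _ _ (hw.2 v hv.1 h)
    (hv.2 w hw.1 (Ne.symm h))

lemma shortlex_append {v l : List (Fin n × Fin n)} (h : List.Shortlex varLT v l)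
    (b : List (Fin n × Fin n)) : List.Shortlex varLT (v ++ b) (l ++ b) := by
  rw [List.shortlex_def] at h ⊢
  rcases h with h | ⟨h, h'⟩
  · left; simpa using h
  · refine Or.inr ⟨by simpa using h, ?_⟩
    induction h' with
    | nil => simp at h
    | cons _ ih => exact .cons (ih (by simpa using h))
    | rel hr => exact .rel hr

lemma mul_mem_below {f : Alg n} {l : List (Fin n × Fin n)} (hf : f ∈ below l)
    (a b : List (Fin n × Fin n)) : mon a * f * mon b ∈ below (a ++ l ++ b) := by
  suffices h : below l ≤ (below (a ++ l ++ b)).comap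
      (LinearMap.mulRight ℂ (mon b) ∘ₗ LinearMap.mulLeft ℂ (mon a)) from h hf
  refine Submodule.span_le.2 ?_
  rintro _ ⟨v, hv, rfl⟩
  simp only [Submodule.comap_coe, Set.mem_preimage, LinearMap.comp_apply, LinearMap.mulLeft_apply,
    LinearMap.mulRight_apply, ← mon_append]
  exact mon_mem_below (shortlex_append (hv.append_left a) b)

end Monomials

/-! ### The graded spaces and their raising and lowering operators -/

/-- One graded piece of the algebra `ℂ⟨e_1, …, e_n⟩ / (∑ e_i, e_i²)`, with the data needed to build
the next one: idempotents `p i` (whose kernel is the image of multiplication by `e_i` from the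
preceding piece) which sum to the scalar `(r + 1) / r`. -/
structure Stage (n : ℕ) (r : ℂ) where
  X : Type
  [acg : AddCommGroup X]
  [mod : Module ℂ X]
  p : Fin n → X →ₗ[ℂ] X
  p_p : ∀ i x, p i (p i x) = p i x
  sum_p : ∀ x, r • ∑ i, p i x = (r + 1) • x

namespace Stage

attribute [instance] Stage.acg Stage.mod

variable {n : ℕ} {r : ℂ} (S : Stage n r)

/-- The relations of the next graded piece, as a subspace of `n` copies of the present one: the
constant families express `∑ e_a = 0`, and the family with `x - p_a x` in place `a` expresses
`e_a² = 0`. -/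
def rel : Submodule ℂ (Fin n → S.X) :=
  LinearMap.range (LinearMap.pi fun _ : Fin n => (LinearMap.id : S.X →ₗ[ℂ] S.X)) ⊔
    ⨆ a, LinearMap.range (LinearMap.single ℂ (fun _ : Fin n => S.X) a ∘ₗ (LinearMap.id - S.p a))

/-- The next graded piece. -/
abbrev NextX : Type := (Fin n → S.X) ⧸ S.rel

/-- Multiplication by the generator `e_a`, into the next graded piece. -/
def raise (a : Fin n) : S.X →ₗ[ℂ] S.NextX := S.rel.mkQ ∘ₗ LinearMap.single ℂ (fun _ : Fin n => S.X)
  a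

lemma sum_raise (x : S.X) : ∑ a, S.raise a x = 0 := by
  simp only [raise, LinearMap.comp_apply, ← map_sum]
  rw [Submodule.mkQ_apply, Submodule.Quotient.mk_eq_zero]
  refine Submodule.mem_sup_left (LinearMap.mem_range.2 ⟨x, ?_⟩)
  ext i
  simp [Pi.single_apply]

lemma raise_p (a : Fin n) (x : S.X) : S.raise a (S.p a x) = S.raise a x := by
  rw [eq_comm, ← sub_eq_zero, ← map_sub]
  simp only [raise, LinearMap.comp_apply, Submodule.mkQ_apply, Submodule.Quotient.mk_eq_zero]
  exact Submodule.mem_sup_right (Submodule.mem_iSup_of_mem a ⟨x, rfl⟩)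

lemma exists_eq_sum_raise (z : S.NextX) : ∃ x : Fin n → S.X, z = ∑ a, S.raise a (x a) := by
  obtain ⟨x, rfl⟩ := S.rel.mkQ_surjective z
  refine ⟨x, ?_⟩
  simp only [raise, LinearMap.comp_apply, ← map_sum]
  congr 1
  ext i
  simp [Pi.single_apply]

lemma hom_ext {Y : Type*} [AddCommGroup Y] [Module ℂ Y] {f g : S.NextX →ₗ[ℂ] Y}
    (h : ∀ a x, f (S.raise a x) = g (S.raise a x)) : f = g := by
  refine LinearMap.ext fun z => ?_
  obtain ⟨x, rfl⟩ := S.exists_eq_sum_raise z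
  simp [h]

/-- The universal property of the next graded piece. -/
def lift {Y : Type*} [AddCommGroup Y] [Module ℂ Y] (φ : Fin n → S.X →ₗ[ℂ] Y)
    (h₁ : ∀ x, ∑ a, φ a x = 0) (h₂ : ∀ a x, φ a (S.p a x) = φ a x) : S.NextX →ₗ[ℂ] Y :=
  S.rel.liftQ (∑ a, φ a ∘ₗ LinearMap.proj a) <| by
    refine sup_le ?_ (iSup_le fun a => ?_)
    · rintro _ ⟨x, rfl⟩
      simpa using h₁ x
    · rintro _ ⟨x, rfl⟩
      rw [LinearMap.mem_ker, LinearMap.sum_apply, Finset.sum_eq_single a]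
      · simp [h₂]
      · intro b _ hb
        simp [Pi.single_eq_of_ne hb]
      · simp

@[simp] lemma lift_raise {Y : Type*} [AddCommGroup Y] [Module ℂ Y] (φ : Fin n → S.X →ₗ[ℂ] Y)
    (h₁ : ∀ x, ∑ a, φ a x = 0) (h₂ : ∀ a x, φ a (S.p a x) = φ a x) (a : Fin n) (x : S.X) :
    S.lift φ h₁ h₂ (S.raise a x) = φ a x := by
  simp only [lift, raise, LinearMap.comp_apply, Submodule.mkQ_apply]
  refine (Submodule.liftQ_apply ..).trans ?_
  rw [LinearMap.sum_apply, Finset.sum_eq_single a]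
  · simp
  · intro b _ hb
    simp [Pi.single_eq_of_ne hb]
  · simp

lemma sum_ite_smul {Y : Type*} [AddCommGroup Y] [Module ℂ Y] (i : Fin n) (y : Fin n → Y) :
    ∑ a, (if a = i then (1 : ℂ) else -r) • y a = (1 + r) • y i - r • ∑ a, y a := by
  have : ∀ a, (if a = i then (1 : ℂ) else -r) • y a
      = (if a = i then (1 + r) • y i else 0) - r • y a := by
    intro a
    split_ifs with h
    · subst h; module
    · module
  simp [this, Finset.sum_sub_distrib, Finset.smul_sum]

/-- The lowering operator `G_i`, determined by `G_i e_i = p_i` and `G_i e_a = -r p_i p_a` for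
`a ≠ i`. It respects `∑ e_a = 0` because of the value of `∑ p_a`. -/
def lower (i : Fin n) : S.NextX →ₗ[ℂ] S.X :=
  S.lift (fun a => (if a = i then (1 : ℂ) else -r) • (S.p i ∘ₗ S.p a))
    (by
      intro x
      simp only [LinearMap.smul_apply, LinearMap.comp_apply]
      rw [sum_ite_smul, S.p_p, ← map_sum, ← map_smul (S.p i) r, S.sum_p, map_smul]
      module)
    (by intro a x; simp only [LinearMap.smul_apply, LinearMap.comp_apply, S.p_p])

lemma lower_raise (i a : Fin n) (x : S.X) :
    S.lower i (S.raise a x) = (if a = i then (1 : ℂ) else -r) • S.p i (S.p a x) := by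
  simp only [lower, lift_raise, LinearMap.smul_apply, LinearMap.comp_apply]

lemma lower_raise_self (i : Fin n) (x : S.X) : S.lower i (S.raise i x) = S.p i x := by
  simp only [lower_raise, S.p_p, if_true, one_smul]

lemma p_lower (i : Fin n) (z : S.NextX) : S.p i (S.lower i z) = S.lower i z := by
  obtain ⟨x, rfl⟩ := S.exists_eq_sum_raise z
  simp only [map_sum, lower_raise, map_smul, S.p_p]

lemma sum_lower (z : S.NextX) : ∑ i, S.lower i z = 0 := by
  suffices h : ∑ i, S.lower i = 0 by simpa using LinearMap.congr_fun h z
  refine S.hom_ext fun a x => ?_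
  have h := sum_ite_smul (r := r) a fun i => S.p i (S.p a x)
  simp only [LinearMap.sum_apply, lower_raise, LinearMap.zero_apply]
  simp only [eq_comm (a := a), h, S.sum_p, S.p_p]
  module

lemma sum_raise_lower (z : S.NextX) : ∑ i, S.raise i (S.lower i z) = (r + 1) • z := by
  suffices h : ∑ i, S.raise i ∘ₗ S.lower i = (r + 1) • LinearMap.id by
    simpa using LinearMap.congr_fun h z
  refine S.hom_ext fun a x => ?_
  have h := sum_ite_smul (r := r) a fun i => S.raise i (S.p a x)
  simp only [LinearMap.sum_apply, LinearMap.comp_apply, lower_raise, map_smul, raise_p,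
    LinearMap.smul_apply,
    LinearMap.id_apply]
  simp only [eq_comm (a := a), h, sum_raise, raise_p]
  module

/-- The next graded piece as a stage, with idempotents `1 - e_i G_i`. The relation between `r` and
`r'` is the one that gives their sum the value required at `r'`. -/
def next {r' : ℂ} (h : r' * (n - 2 - r) = 1) : Stage n r' where
  X := S.NextX
  p i := LinearMap.id - S.raise i ∘ₗ S.lower i
  p_p i z := by
    simp [lower_raise_self, p_lower]
  sum_p z := by
    simp only [LinearMap.sub_apply, LinearMap.comp_apply, LinearMap.id_apply,
      Finset.sum_sub_distrib, sum_raise_lower, Finset.sum_const, Finset.card_univ, Fintype.card_fin]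
    rw [← Nat.cast_smul_eq_nsmul ℂ, ← sub_smul, smul_smul]
    congr 1
    linear_combination h

end Stage

/-- The scalars `r_k` relating consecutive graded pieces, `r_0 = 1 / (n - 1)` and
`r_{k+1} = 1 / (n - 2 - r_k)`. They are the quotients `d_k / d_{k+1}` of the solution of
`d_{k+2} = (n - 2) d_{k+1} - d_k` with `d_0 = 1`, `d_1 = n - 1`, so that `d_k = dim R_k`. -/
def ratio (n : ℕ) : ℕ → ℂ
  | 0 => 1 / (n - 1)
  | k + 1 => 1 / (n - 2 - ratio n k)

section

variable {n : ℕ}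

/-- For `n ≥ 4` the scalars `r_k` are real and lie in `(0, 1]`, so that no denominator vanishes. -/
lemma exists_ratio_eq (hn : 4 ≤ n) (k : ℕ) : ∃ x : ℝ, 0 < x ∧ x ≤ 1 ∧ ratio n k = x := by
  have h4 : (4 : ℝ) ≤ n := by exact_mod_cast hn
  induction k with
  | zero =>
    refine ⟨1 / (n - 1), by apply one_div_pos.2; linarith, ?_, by simp [ratio]⟩
    rw [div_le_one (by linarith)]; linarith
  | succ k ih =>
    obtain ⟨x, h0, h1, hx⟩ := ih
    refine ⟨1 / (n - 2 - x), by apply one_div_pos.2; linarith, ?_, by simp [ratio, hx]⟩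
    rw [div_le_one (by linarith)]; linarith

lemma ratio_add_one_ne_zero (hn : 4 ≤ n) (k : ℕ) : ratio n k + 1 ≠ 0 := by
  obtain ⟨x, h0, -, hx⟩ := exists_ratio_eq hn k
  rw [hx]; norm_cast; linarith

lemma ratio_zero_mul (hn : 4 ≤ n) : ratio n 0 * n = ratio n 0 + 1 := by
  have h4 : (n : ℂ) - 1 ≠ 0 := by
    rw [sub_ne_zero]; norm_cast; omega
  rw [ratio]; field_simp; ring

lemma ratio_succ_mul (hn : 4 ≤ n) (k : ℕ) : ratio n (k + 1) * (n - 2 - ratio n k) = 1 := by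
  have h4 : (4 : ℝ) ≤ n := by exact_mod_cast hn
  obtain ⟨x, h0, h1, hx⟩ := exists_ratio_eq hn k
  rw [ratio]
  apply one_div_mul_cancel
  rw [hx]
  norm_cast
  intro h
  have : (n : ℝ) - 2 - x = 0 := by exact_mod_cast h
  linarith

end

section

variable {n : ℕ} (hn : 4 ≤ n)

/-- The graded piece `R_k` of `ℂ⟨e_1, …, e_n⟩ / (∑ e_i, e_i²)`, starting from `R_0 = ℂ`. -/
def stage : (k : ℕ) → Stage n (ratio n k)
  | 0 =>
    { X := ℂ
      p := fun _ => LinearMap.id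
      p_p := fun _ _ => rfl
      sum_p := fun x => by
        have h := ratio_zero_mul hn
        simp only [LinearMap.id_apply, Finset.sum_const, Finset.card_univ, Fintype.card_fin,
          nsmul_eq_mul, smul_eq_mul]
        linear_combination x * h }
  | k + 1 => (stage k).next (ratio_succ_mul hn k)

/-! ### A representation of the quantum symmetry relations -/

/-- The space on which the magic unitary acts: the product over `k` of `R_k ⊗ R_k`. -/
abbrev Rep : Type := ∀ k, (stage hn k).X ⊗[ℂ] (stage hn k).X

/-- The generator `e_i` as an operator `R_k → R_{k+1}`. -/
def raise (k : ℕ) (i : Fin n) : (stage hn k).X →ₗ[ℂ] (stage hn (k + 1)).X := (stage hn k).raise i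

/-- The lowering operator `G_i : R_{k+1} → R_k`. -/
def lower (k : ℕ) (i : Fin n) : (stage hn (k + 1)).X →ₗ[ℂ] (stage hn k).X := (stage hn k).lower i

/-- The idempotent `p_i` on `R_k`. -/
def p (k : ℕ) (i : Fin n) : (stage hn k).X →ₗ[ℂ] (stage hn k).X := (stage hn k).p i

lemma p_succ (k : ℕ) (i : Fin n) : p hn (k + 1) i = LinearMap.id - raise hn k i ∘ₗ lower hn k i :=
  rfl
lemma p_zero (i : Fin n) : p hn 0 i = LinearMap.id := rfl

lemma p_comp_p (k : ℕ) (i : Fin n) : p hn k i ∘ₗ p hn k i = p hn k i :=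
  LinearMap.ext fun x => (stage hn k).p_p i x
lemma raise_comp_p (k : ℕ) (i : Fin n) : raise hn k i ∘ₗ p hn k i = raise hn k i :=
  LinearMap.ext fun x => (stage hn k).raise_p i x
lemma p_comp_lower (k : ℕ) (i : Fin n) : p hn k i ∘ₗ lower hn k i = lower hn k i :=
  LinearMap.ext fun x => (stage hn k).p_lower i x
lemma lower_comp_raise_self (k : ℕ) (i : Fin n) : lower hn k i ∘ₗ raise hn k i = p hn k i :=
  LinearMap.ext fun x => (stage hn k).lower_raise_self i x
lemma lower_comp_raise_of_ne (k : ℕ) {i j : Fin n} (h : i ≠ j) :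
    lower hn k i ∘ₗ raise hn k j = -ratio n k • p hn k i ∘ₗ p hn k j :=
  LinearMap.ext fun x => by
    refine ((stage hn k).lower_raise i j x).trans ?_
    rw [if_neg h.symm]
    rfl
lemma p_comp_raise (k : ℕ) (i : Fin n) : p hn (k + 1) i ∘ₗ raise hn k i = 0 := by
  rw [p_succ, LinearMap.sub_comp, LinearMap.comp_assoc, lower_comp_raise_self, raise_comp_p]
  simp
lemma lower_comp_p (k : ℕ) (i : Fin n) : lower hn k i ∘ₗ p hn (k + 1) i = 0 := by
  rw [p_succ, LinearMap.comp_sub, ← LinearMap.comp_assoc, lower_comp_raise_self, p_comp_lower]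
  simp
lemma sum_raise (k : ℕ) : ∑ i, raise hn k i = 0 :=
  LinearMap.ext fun x => by
    rw [LinearMap.sum_apply]
    exact (stage hn k).sum_raise x
lemma sum_lower (k : ℕ) : ∑ i, lower hn k i = 0 :=
  LinearMap.ext fun x => by
    rw [LinearMap.sum_apply]
    exact (stage hn k).sum_lower x
lemma sum_raise_lower (k : ℕ) : ∑ i, raise hn k i ∘ₗ lower hn k i = (ratio n k + 1) • LinearMap.id
  :=
  LinearMap.ext fun x => by
    rw [LinearMap.sum_apply]
    exact (stage hn k).sum_raise_lower x
lemma sum_p (k : ℕ) : ratio n k • ∑ i, p hn k i = (ratio n k + 1) • LinearMap.id :=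
  LinearMap.ext fun x => by
    rw [LinearMap.smul_apply, LinearMap.sum_apply]
    exact (stage hn k).sum_p x

/-- The right factor of the operator `u_{ij}`: it maps onto the image of `slot i j`. -/
def down (i j : Fin n) : Rep hn →ₗ[ℂ] Rep hn :=
  LinearMap.pi fun k =>
    TensorProduct.map (p hn k i) (p hn k j) ∘ₗ LinearMap.proj k +
    (ratio n k + 1)⁻¹ • TensorProduct.map (lower hn k i) (lower hn k j) ∘ₗ LinearMap.proj (k + 1)

/-- The component in degree `k` of the operator `e_i ⊗ e_j` of degree one. -/
def upShift (i j : Fin n) : (k : ℕ) → Rep hn →ₗ[ℂ] (stage hn k).X ⊗[ℂ] (stage hn k).X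
  | 0 => 0
  | k + 1 => TensorProduct.map (raise hn k i) (raise hn k j) ∘ₗ LinearMap.proj k

/-- The left factor of the operator `u_{ij}`; it is a section of `down i j` on `slot i j`. -/
def up (i j : Fin n) : Rep hn →ₗ[ℂ] Rep hn :=
  LinearMap.pi fun k =>
    (ratio n k * (ratio n k + 1)⁻¹) •
      TensorProduct.map (p hn k i) (p hn k j) ∘ₗ LinearMap.proj k + upShift hn i j k

/-- The entry `u_{ij}` of the magic unitary acting on `Rep`. -/
def magic (i j : Fin n) : Module.End ℂ (Rep hn) := up hn i j ∘ₗ down hn i j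

lemma upShift_zero (i j : Fin n) (f : Rep hn) : upShift hn i j 0 f = 0 := rfl
lemma upShift_succ (i j : Fin n) (k : ℕ) (f : Rep hn) :
    upShift hn i j (k + 1) f = TensorProduct.map (raise hn k i) (raise hn k j) (f k) := rfl

lemma down_apply (i j : Fin n) (f : Rep hn) (k : ℕ) :
    down hn i j f k = TensorProduct.map (p hn k i) (p hn k j) (f k) +
      (ratio n k + 1)⁻¹ • TensorProduct.map (lower hn k i) (lower hn k j) (f (k + 1)) := rfl

lemma up_apply (i j : Fin n) (f : Rep hn) (k : ℕ) :
    up hn i j f k = (ratio n k * (ratio n k + 1)⁻¹) •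
      TensorProduct.map (p hn k i) (p hn k j) (f k) + upShift hn i j k f := rfl

lemma map_map {V V' V'' W W' W'' : Type*} [AddCommGroup V] [Module ℂ V] [AddCommGroup V']
    [Module ℂ V'] [AddCommGroup V''] [Module ℂ V''] [AddCommGroup W] [Module ℂ W]
    [AddCommGroup W'] [Module ℂ W'] [AddCommGroup W''] [Module ℂ W'']
    (f : V →ₗ[ℂ] V') (f' : V' →ₗ[ℂ] V'') (g : W →ₗ[ℂ] W') (g' : W' →ₗ[ℂ] W'') (x : V ⊗[ℂ] W) :
    TensorProduct.map f' g' (TensorProduct.map f g x) =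
      TensorProduct.map (f' ∘ₗ f) (g' ∘ₗ g) x := by
  rw [TensorProduct.map_comp]; rfl

/-- The idempotent `p_i ⊗ p_j` in every degree. -/
def slot (i j : Fin n) : Rep hn →ₗ[ℂ] Rep hn :=
  LinearMap.pi fun k => TensorProduct.map (p hn k i) (p hn k j) ∘ₗ LinearMap.proj k

lemma slot_apply (i j : Fin n) (f : Rep hn) (k : ℕ) :
    slot hn i j f k = TensorProduct.map (p hn k i) (p hn k j) (f k) := rfl

lemma down_up_self (i j : Fin n) (f : Rep hn) : down hn i j (up hn i j f) = slot hn i j f := by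
  funext k
  have h := ratio_add_one_ne_zero hn k
  simp only [down_apply, up_apply, map_add, map_smul, map_map, upShift_succ, lower_comp_raise_self,
    p_comp_p, lower_comp_p, TensorProduct.map_zero_left, LinearMap.zero_apply, smul_zero, zero_add,
    slot_apply]
  have h2 : TensorProduct.map (p hn k i) (p hn k j) (upShift hn i j k f) = 0 := by
    cases k with
    | zero => rw [upShift_zero, map_zero]
    | succ k => simp [upShift_succ, map_map, p_comp_raise]
  rw [h2, add_zero, ← add_smul]
  have : ratio n k * (ratio n k + 1)⁻¹ + (ratio n k + 1)⁻¹ = 1 := by field_simp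
  rw [this, one_smul]

lemma slot_down (i j : Fin n) (f : Rep hn) : slot hn i j (down hn i j f) = down hn i j f := by
  funext k
  simp only [down_apply, slot_apply, map_add, map_smul, map_map, p_comp_p, p_comp_lower]

lemma magic_mul_self (i j : Fin n) : magic hn i j * magic hn i j = magic hn i j := by
  refine LinearMap.ext fun f => ?_
  simp only [magic, Module.End.mul_apply, LinearMap.comp_apply, down_up_self, slot_down]

/-- The two surviving terms, `b_k p_i ⊗ p_j p_l` and `a_k p_i ⊗ G_j e_l`, cancel since
`G_j e_l = -r_k p_j p_l` and `b_k = r_k a_k`. -/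
lemma down_up_row (i : Fin n) {j l : Fin n} (hjl : j ≠ l) (f : Rep hn) :
    down hn i j (up hn i l f) = 0 := by
  funext k
  simp only [down_apply, up_apply, map_add, map_smul, map_map, upShift_succ, lower_comp_raise_self,
    lower_comp_raise_of_ne hn k hjl, p_comp_p, lower_comp_p, TensorProduct.map_zero_left,
    LinearMap.zero_apply,
    smul_zero, zero_add, TensorProduct.map_smul_right, LinearMap.smul_apply]
  have h2 : TensorProduct.map (p hn k i) (p hn k j) (upShift hn i l k f) = 0 := by
    cases k with
    | zero => rw [upShift_zero, map_zero]
    | succ k => simp [upShift_succ, map_map, p_comp_raise]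
  rw [h2, Pi.zero_apply]
  module

lemma down_up_col (j : Fin n) {i l : Fin n} (hil : i ≠ l) (f : Rep hn) :
    down hn i j (up hn l j f) = 0 := by
  funext k
  simp only [down_apply, up_apply, map_add, map_smul, map_map, upShift_succ, lower_comp_raise_self,
    lower_comp_raise_of_ne hn k hil, p_comp_p, lower_comp_p, TensorProduct.map_zero_right,
    LinearMap.zero_apply, smul_zero, zero_add, TensorProduct.map_smul_left, LinearMap.smul_apply]
  have h2 : TensorProduct.map (p hn k i) (p hn k j) (upShift hn l j k f) = 0 := by
    cases k with
    | zero => rw [upShift_zero, map_zero]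
    | succ k => simp [upShift_succ, map_map, p_comp_raise]
  rw [h2, Pi.zero_apply]
  module

lemma magic_mul_row (i : Fin n) {j l : Fin n} (hjl : j ≠ l) : magic hn i j * magic hn i l = 0 := by
  refine LinearMap.ext fun f => ?_
  simp only [magic, Module.End.mul_apply, LinearMap.comp_apply, down_up_row hn i hjl, map_zero,
    LinearMap.zero_apply]

lemma magic_mul_col (j : Fin n) {i l : Fin n} (hil : i ≠ l) : magic hn i j * magic hn l j = 0 := by
  refine LinearMap.ext fun f => ?_
  simp only [magic, Module.End.mul_apply, LinearMap.comp_apply, down_up_col hn j hil, map_zero,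
    LinearMap.zero_apply]

lemma magic_apply_zero (i j : Fin n) (f : Rep hn) :
    magic hn i j f 0 = (ratio n 0 * (ratio n 0 + 1)⁻¹) •
      (TensorProduct.map (p hn 0 i) (p hn 0 j) (f 0) +
        (ratio n 0 + 1)⁻¹ • TensorProduct.map (lower hn 0 i) (lower hn 0 j) (f 1)) := by
  simp only [magic, LinearMap.comp_apply, up_apply, down_apply, map_add, map_smul, map_map,
    p_comp_p,
    p_comp_lower, upShift_zero, add_zero]

lemma magic_apply_succ (i j : Fin n) (f : Rep hn) (k : ℕ) :
    magic hn i j f (k + 1) = (ratio n (k + 1) * (ratio n (k + 1) + 1)⁻¹) •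
      (TensorProduct.map (p hn (k + 1) i) (p hn (k + 1) j) (f (k + 1)) +
        (ratio n (k + 1) + 1)⁻¹ •
          TensorProduct.map (lower hn (k + 1) i) (lower hn (k + 1) j) (f (k + 2))) +
      (TensorProduct.map (raise hn k i) (raise hn k j) (f k) +
        (ratio n k + 1)⁻¹ • TensorProduct.map (raise hn k i ∘ₗ lower hn k i) (raise hn k j ∘ₗ lower
        hn k j)
          (f (k + 1))) := by
  simp only [magic, LinearMap.comp_apply, up_apply, down_apply, map_add, map_smul, map_map,
    p_comp_p,
    p_comp_lower, upShift_succ, raise_comp_p]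

lemma sum_map_right {ι V V' W W' : Type*} [Fintype ι] [AddCommGroup V] [Module ℂ V]
    [AddCommGroup V'] [Module ℂ V'] [AddCommGroup W] [Module ℂ W] [AddCommGroup W'] [Module ℂ W']
    (f : V →ₗ[ℂ] V') (g : ι → W →ₗ[ℂ] W') (x : V ⊗[ℂ] W) :
    ∑ i, TensorProduct.map f (g i) x = TensorProduct.map f (∑ i, g i) x := by
  rw [← LinearMap.sum_apply]
  exact LinearMap.congr_fun (map_sum (TensorProduct.mapBilinear (RingHom.id ℂ) V W V' W' f) g
    Finset.univ).symm x

lemma sum_map_left {ι V V' W W' : Type*} [Fintype ι] [AddCommGroup V] [Module ℂ V]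
    [AddCommGroup V'] [Module ℂ V'] [AddCommGroup W] [Module ℂ W] [AddCommGroup W'] [Module ℂ W']
    (f : ι → V →ₗ[ℂ] V') (g : W →ₗ[ℂ] W') (x : V ⊗[ℂ] W) :
    ∑ i, TensorProduct.map (f i) g x = TensorProduct.map (∑ i, f i) g x := by
  rw [← LinearMap.sum_apply]
  have h := LinearMap.congr_fun (LinearMap.congr_fun
    (map_sum (TensorProduct.mapBilinear (RingHom.id ℂ) V W V' W') f Finset.univ) g) x
  rw [LinearMap.sum_apply] at h
  exact h.symm

lemma sum_p' (k : ℕ) : (ratio n k * (ratio n k + 1)⁻¹) • ∑ i, p hn k i = LinearMap.id := by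
  have h := ratio_add_one_ne_zero hn k
  rw [mul_comm, mul_smul, sum_p, smul_smul, inv_mul_cancel₀ h, one_smul]

lemma sum_raise_lower' (k : ℕ) :
    (ratio n k + 1)⁻¹ • ∑ i, raise hn k i ∘ₗ lower hn k i = LinearMap.id := by
  have h := ratio_add_one_ne_zero hn k
  rw [sum_raise_lower, smul_smul, inv_mul_cancel₀ h, one_smul]

lemma sum_magic_row (i : Fin n) : ∑ j, magic hn i j = 1 := by
  refine LinearMap.ext fun f => funext fun k => ?_
  simp only [LinearMap.sum_apply, Finset.sum_apply, Module.End.one_apply]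
  cases k with
  | zero =>
    simp only [magic_apply_zero, ← Finset.smul_sum, Finset.sum_add_distrib, sum_map_right,
      sum_lower,
      TensorProduct.map_zero_right, LinearMap.zero_apply, smul_zero, add_zero]
    rw [← LinearMap.smul_apply, ← TensorProduct.map_smul_right, sum_p', p_zero,
      TensorProduct.map_id, LinearMap.id_apply]
  | succ k =>
    simp only [magic_apply_succ, ← Finset.smul_sum, Finset.sum_add_distrib, sum_map_right,
      sum_lower,
      sum_raise, TensorProduct.map_zero_right, LinearMap.zero_apply, smul_zero, add_zero, zero_add]
    rw [← LinearMap.smul_apply, ← TensorProduct.map_smul_right, sum_p', ← LinearMap.smul_apply,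
      ← TensorProduct.map_smul_right, sum_raise_lower', ← LinearMap.add_apply,
      ← TensorProduct.map_add_left, p_succ, sub_add_cancel, TensorProduct.map_id,
      LinearMap.id_apply]

lemma sum_magic_col (j : Fin n) : ∑ i, magic hn i j = 1 := by
  refine LinearMap.ext fun f => funext fun k => ?_
  simp only [LinearMap.sum_apply, Finset.sum_apply, Module.End.one_apply]
  cases k with
  | zero =>
    simp only [magic_apply_zero, ← Finset.smul_sum, Finset.sum_add_distrib, sum_map_left, sum_lower,
      TensorProduct.map_zero_left, LinearMap.zero_apply, smul_zero, add_zero]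
    rw [← LinearMap.smul_apply, ← TensorProduct.map_smul_left, sum_p', p_zero,
      TensorProduct.map_id, LinearMap.id_apply]
  | succ k =>
    simp only [magic_apply_succ, ← Finset.smul_sum, Finset.sum_add_distrib, sum_map_left, sum_lower,
      sum_raise, TensorProduct.map_zero_left, LinearMap.zero_apply, smul_zero, add_zero, zero_add]
    rw [← LinearMap.smul_apply, ← TensorProduct.map_smul_left, sum_p', ← LinearMap.smul_apply,
      ← TensorProduct.map_smul_left, sum_raise_lower', ← LinearMap.add_apply,
      ← TensorProduct.map_add_right, p_succ, sub_add_cancel, TensorProduct.map_id,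
      LinearMap.id_apply]

end

/-! ### The action of the generators on normal words -/

section NormalWords

variable {n : ℕ} (hn : 4 ≤ n)

/-- Putting the letter `a` in front of the word creates none of the factors `aa`, `23`, `243` at its
beginning. -/
def CanPrepend (a : Fin n) : List (Fin n) → Prop
  | [] => True
  | b :: w => a ≠ b ∧ ¬(a = i2 hn ∧ b = i3 hn) ∧ ¬(a = i2 hn ∧ b = i4 hn ∧ w.head? = some (i3 hn))

/-- The words in the letters `2, …, n` without equal adjacent letters and without the factors `23`
and `243`. -/
def IsNormal : List (Fin n) → Prop
  | [] => True
  | a :: w => a ≠ i1 hn ∧ CanPrepend hn a w ∧ IsNormal w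

lemma i1_ne_i2 : i1 hn ≠ i2 hn := by simp [i1, i2]
lemma i1_ne_i3 : i1 hn ≠ i3 hn := by simp [i1, i3]
lemma i1_ne_i4 : i1 hn ≠ i4 hn := by simp [i1, i4]
lemma i2_ne_i3 : i2 hn ≠ i3 hn := by simp [i2, i3]
lemma i2_ne_i4 : i2 hn ≠ i4 hn := by simp [i2, i4]
lemma i3_ne_i4 : i3 hn ≠ i4 hn := by simp [i3, i4]

open Classical in
/-- For a normal word `w`, the only letter `b ≠ 2` for which `b w` is normal but `2 b w` is not. -/
def twist (w : List (Fin n)) : Fin n := if w.head? = some (i3 hn) then i4 hn else i3 hn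

lemma twist_ne_i2 (w : List (Fin n)) : twist hn w ≠ i2 hn := by
  unfold twist
  split_ifs
  exacts [(i2_ne_i4 hn).symm, (i2_ne_i3 hn).symm]

lemma isNormal_twist_cons {w : List (Fin n)} (h : IsNormal hn w) :
    IsNormal hn (twist hn w :: w) := by
  have h13 := i1_ne_i3 hn
  have h14 := i1_ne_i4 hn
  have h23 := i2_ne_i3 hn
  have h24 := i2_ne_i4 hn
  have h34 := i3_ne_i4 hn
  unfold twist
  cases w with
  | nil => simp [IsNormal, CanPrepend, h13.symm]
  | cons b w =>
    by_cases hb : b = i3 hn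
    · subst hb
      simp [IsNormal, CanPrepend, h14.symm, h34.symm, h24.symm] at h ⊢
      exact h
    · simp [hb, IsNormal, CanPrepend, h13.symm, h23.symm, Ne.symm hb] at h ⊢
      exact h

lemma eq_twist_iff {w : List (Fin n)} {b : Fin n} (hb : b ≠ i2 hn) (h : IsNormal hn (b :: w)) :
    b = twist hn w ↔ ¬ IsNormal hn (i2 hn :: b :: w) := by
  have h12 := i1_ne_i2 hn
  have h' : IsNormal hn (i2 hn :: b :: w) ↔ CanPrepend hn (i2 hn) (b :: w) := by
    simp only [IsNormal] at h ⊢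
    tauto
  have hw : b = i3 hn → w.head? ≠ some (i3 hn) := by
    rintro rfl hw
    cases w with
    | nil => simp at hw
    | cons c w =>
      simp only [List.head?_cons, Option.some.injEq] at hw
      exact h.2.1.1 hw.symm
  rw [h']
  simp only [CanPrepend, twist]
  split_ifs with h3
  · have : b ≠ i3 hn := fun h => hw h h3
    simp [hb.symm, this, h3]
  · simp [hb.symm, h3]

open Classical in
/-- Prepend the letter `a` to a word, the result being `0` if it is not normal. -/
def pre (a : Fin n) : (List (Fin n) →₀ ℂ) →ₗ[ℂ] (List (Fin n) →₀ ℂ) :=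
  Finsupp.linearCombination ℂ fun w =>
    if IsNormal hn (a :: w) then Finsupp.single (a :: w) 1 else 0

/-- The sum of the operators `pre b` over `b ≠ 2`; the term for the letter `1` vanishes. -/
def preSum : (List (Fin n) →₀ ℂ) →ₗ[ℂ] (List (Fin n) →₀ ℂ) :=
  ∑ a ∈ Finset.univ.erase (i2 hn), pre hn a

open Classical in
/-- The action of `e_2` on a word. It prepends `2` where this gives a normal word. On a normal word
`b w` with `2 b w` not normal, the value is the one forced by `(e_2 + ⋯ + e_n)² w = 0` and
`e_2² w = 0`, solved for `e_2 e_b w`. -/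
def letterTwoWord : List (Fin n) → List (Fin n) →₀ ℂ
  | [] => Finsupp.single [i2 hn] 1
  | a :: w =>
    if IsNormal hn (i2 hn :: a :: w) then Finsupp.single (i2 hn :: a :: w) 1
    else if IsNormal hn (a :: w) ∧ a ≠ i2 hn then
      -preSum hn (letterTwoWord w + preSum hn (Finsupp.single w 1)) -
        pre hn (i2 hn) (preSum hn (Finsupp.single w 1))
    else 0

/-- The action of `e_2` on combinations of words. -/
def letterTwo : (List (Fin n) →₀ ℂ) →ₗ[ℂ] (List (Fin n) →₀ ℂ) :=
  Finsupp.linearCombination ℂ (letterTwoWord hn)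

lemma pre_of_normal {a : Fin n} {w : List (Fin n)} (h : IsNormal hn (a :: w)) :
    pre hn a (Finsupp.single w 1) = Finsupp.single (a :: w) 1 := by
  simp [pre, h]

lemma pre_of_not_normal {a : Fin n} {w : List (Fin n)} (h : ¬ IsNormal hn (a :: w)) :
    pre hn a (Finsupp.single w 1) = 0 := by
  simp [pre, h]

lemma preSum_single (w : List (Fin n)) : preSum hn (Finsupp.single w 1) =
    ∑ a ∈ Finset.univ.erase (i2 hn), pre hn a (Finsupp.single w 1) := by
  simp [preSum]

lemma letterTwo_single (w : List (Fin n)) :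
    letterTwo hn (Finsupp.single w 1) = letterTwoWord hn w := by
  simp [letterTwo]

lemma letterTwo_of_not_normal {w : List (Fin n)} (h : ¬ IsNormal hn w) :
    letterTwo hn (Finsupp.single w 1) = 0 := by
  rw [letterTwo_single]
  cases w with
  | nil => simp [IsNormal] at h
  | cons a w =>
    have h' : ¬ IsNormal hn (i2 hn :: a :: w) := fun h' => h h'.2.2
    simp [letterTwoWord, h, h']

lemma letterTwo_of_normal {w : List (Fin n)} (h : IsNormal hn (i2 hn :: w)) :
    letterTwo hn (Finsupp.single w 1) = Finsupp.single (i2 hn :: w) 1 := by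
  rw [letterTwo_single]
  cases w with
  | nil => simp [letterTwoWord]
  | cons a w => simp [letterTwoWord, h]

lemma letterTwo_pre_i2 (x : List (Fin n) →₀ ℂ) : letterTwo hn (pre hn (i2 hn) x) = 0 := by
  suffices h : letterTwo hn ∘ₗ pre hn (i2 hn) = 0 from LinearMap.congr_fun h x
  refine Finsupp.lhom_ext' fun w => LinearMap.ext_ring ?_
  simp only [LinearMap.comp_apply, Finsupp.lsingle_apply, LinearMap.zero_apply]
  by_cases h : IsNormal hn (i2 hn :: w)
  · have h' : ¬ IsNormal hn (i2 hn :: i2 hn :: w) := fun h' => h'.2.1.1 rfl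
    rw [pre_of_normal hn h, letterTwo_single]
    simp [letterTwoWord, h']
  · rw [pre_of_not_normal hn h, map_zero]

lemma letterTwo_pre_of_ne {w : List (Fin n)} {b : Fin n} (hb : b ≠ i2 hn)
    (hbw : b ≠ twist hn w) :
    letterTwo hn (pre hn b (Finsupp.single w 1)) =
      pre hn (i2 hn) (pre hn b (Finsupp.single w 1)) := by
  by_cases h : IsNormal hn (b :: w)
  · have h' : IsNormal hn (i2 hn :: b :: w) := by
      by_contra h'
      exact hbw ((eq_twist_iff hn hb h).2 h')
    rw [pre_of_normal hn h, letterTwo_of_normal hn h', pre_of_normal hn h']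
  · simp [pre_of_not_normal hn h]

/-- On normal words `e_2 (e_3 + ⋯ + e_n) = -(e_3 + ⋯ + e_n)(e_2 + ⋯ + e_n)`: the exceptional letter
`twist w` contributes the right-hand side by definition of `letterTwoWord`, less the sum of the
terms contributed by the other letters. -/
lemma letterTwo_preSum {w : List (Fin n)} (hw : IsNormal hn w) :
    letterTwo hn (preSum hn (Finsupp.single w 1)) =
      -preSum hn (letterTwo hn (Finsupp.single w 1) + preSum hn (Finsupp.single w 1)) := by
  have hc := isNormal_twist_cons hn hw
  have hc2 := twist_ne_i2 hn w
  have hc3 := (eq_twist_iff hn hc2 hc).1 rfl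
  have hmem : twist hn w ∈ Finset.univ.erase (i2 hn) := by simp [hc2]
  have key : letterTwo hn (pre hn (twist hn w) (Finsupp.single w 1)) =
      -preSum hn (letterTwo hn (Finsupp.single w 1) + preSum hn (Finsupp.single w 1)) -
        pre hn (i2 hn) (preSum hn (Finsupp.single w 1)) := by
    rw [pre_of_normal hn hc, letterTwo_single, letterTwoWord, if_neg hc3, if_pos ⟨hc, hc2⟩,
      letterTwo_single]
  have h1 : pre hn (i2 hn) (preSum hn (Finsupp.single w 1)) =
      ∑ b ∈ (Finset.univ.erase (i2 hn)).erase (twist hn w),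
        pre hn (i2 hn) (pre hn b (Finsupp.single w 1)) := by
    rw [preSum_single, map_sum, ← Finset.add_sum_erase _ _ hmem, pre_of_normal hn hc,
      pre_of_not_normal hn hc3, zero_add]
  have h2 : letterTwo hn (preSum hn (Finsupp.single w 1)) =
      letterTwo hn (pre hn (twist hn w) (Finsupp.single w 1)) +
        pre hn (i2 hn) (preSum hn (Finsupp.single w 1)) := by
    rw [h1]
    conv_lhs => rw [preSum_single, map_sum, ← Finset.add_sum_erase _ _ hmem]
    congr 1
    refine Finset.sum_congr rfl fun b hb => ?_
    simp only [Finset.mem_erase, Finset.mem_univ, and_true] at hb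
    exact letterTwo_pre_of_ne hn hb.2 hb.1
  rw [h2, key]
  abel

/-- The action of `e_2 + ⋯ + e_n`. -/
def letterSum : (List (Fin n) →₀ ℂ) →ₗ[ℂ] (List (Fin n) →₀ ℂ) := letterTwo hn + preSum hn

lemma preSum_of_not_normal {w : List (Fin n)} (h : ¬ IsNormal hn w) :
    preSum hn (Finsupp.single w 1) = 0 := by
  rw [preSum_single]
  exact Finset.sum_eq_zero fun a _ => pre_of_not_normal hn fun h' => h h'.2.2

/-- Independently of whether `e_2` squares to zero, `(e_2 + ⋯ + e_n)² = e_2²` as operators. -/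
lemma letterSum_letterSum (x : List (Fin n) →₀ ℂ) :
    letterSum hn (letterSum hn x) = letterTwo hn (letterTwo hn x) := by
  suffices h : letterSum hn ∘ₗ letterSum hn = letterTwo hn ∘ₗ letterTwo hn from
    LinearMap.congr_fun h x
  refine Finsupp.lhom_ext' fun w => LinearMap.ext_ring ?_
  simp only [LinearMap.comp_apply, Finsupp.lsingle_apply, letterSum, LinearMap.add_apply]
  by_cases h : IsNormal hn w
  · rw [map_add (letterTwo hn), letterTwo_preSum hn h]
    abel
  · simp [letterTwo_of_not_normal hn h, preSum_of_not_normal hn h]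

/-- The only case in question is a word `b w` with `b = twist w`. By `letterSum_letterSum`, the
operators `e_2²` and `s = e_2 + ⋯ + e_n` commute, so `e_2² (s w) = s (e_2² w) = 0` by induction, and
`b w` is the only term of `s w` on which `e_2²` is not already known to vanish. -/
lemma letterTwo_letterTwo (x : List (Fin n) →₀ ℂ) : letterTwo hn (letterTwo hn x) = 0 := by
  suffices h : letterTwo hn ∘ₗ letterTwo hn = 0 from LinearMap.congr_fun h x
  refine Finsupp.lhom_ext' fun w => LinearMap.ext_ring ?_
  simp only [LinearMap.comp_apply, Finsupp.lsingle_apply, LinearMap.zero_apply]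
  induction w with
  | nil =>
    have h : IsNormal hn [i2 hn] := by simp [IsNormal, CanPrepend, (i1_ne_i2 hn).symm]
    rw [letterTwo_of_normal hn h, ← pre_of_normal hn h, letterTwo_pre_i2]
  | cons a w ih =>
    by_cases h : IsNormal hn (a :: w)
    swap
    · rw [letterTwo_of_not_normal hn h, map_zero]
    by_cases ha : a = i2 hn
    · subst ha
      rw [← pre_of_normal hn h, letterTwo_pre_i2, map_zero]
    by_cases h2 : IsNormal hn (i2 hn :: a :: w)
    · rw [letterTwo_of_normal hn h2, ← pre_of_normal hn h2, letterTwo_pre_i2]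
    have hat := (eq_twist_iff hn ha h).2 h2
    have h3 : letterTwo hn (letterTwo hn (letterSum hn (Finsupp.single w 1))) = 0 := by
      rw [← letterSum_letterSum, letterSum_letterSum hn (Finsupp.single w 1), ih, map_zero]
    have h4 : letterTwo hn (letterTwo hn (preSum hn (Finsupp.single w 1))) = 0 := by
      rwa [letterSum, LinearMap.add_apply, map_add, map_add, ih, map_zero, zero_add] at h3
    rw [preSum_single, map_sum, map_sum, Finset.sum_eq_single (twist hn w)] at h4
    · rwa [← hat, pre_of_normal hn h] at h4
    · intro b hb hbt
      rw [letterTwo_pre_of_ne hn (Finset.ne_of_mem_erase hb) hbt, letterTwo_pre_i2]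
    · intro h'
      simp [twist_ne_i2] at h'

lemma pre_pre (a : Fin n) (x : List (Fin n) →₀ ℂ) : pre hn a (pre hn a x) = 0 := by
  suffices h : pre hn a ∘ₗ pre hn a = 0 from LinearMap.congr_fun h x
  refine Finsupp.lhom_ext' fun w => LinearMap.ext_ring ?_
  simp only [LinearMap.comp_apply, Finsupp.lsingle_apply, LinearMap.zero_apply]
  by_cases h : IsNormal hn (a :: w)
  · have h' : ¬ IsNormal hn (a :: a :: w) := fun h' => h'.2.1.1 rfl
    rw [pre_of_normal hn h, pre_of_not_normal hn h']
  · rw [pre_of_not_normal hn h, map_zero]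

lemma pre_i1 : pre hn (i1 hn) = 0 := by
  refine Finsupp.lhom_ext' fun w => LinearMap.ext_ring ?_
  exact pre_of_not_normal hn fun h => h.1 rfl

open Classical in
/-- The action of the generator `e_a`; that of `e_1` is fixed by `∑ e_a = 0`. -/
def letter (a : Fin n) : (List (Fin n) →₀ ℂ) →ₗ[ℂ] (List (Fin n) →₀ ℂ) :=
  if a = i1 hn then -letterSum hn else if a = i2 hn then letterTwo hn else pre hn a

lemma letter_letter (a : Fin n) (x : List (Fin n) →₀ ℂ) : letter hn a (letter hn a x) = 0 := by
  unfold letter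
  split_ifs
  · simp [letterSum_letterSum, letterTwo_letterTwo]
  · exact letterTwo_letterTwo hn x
  · exact pre_pre hn a x

lemma sum_letter (x : List (Fin n) →₀ ℂ) : ∑ a, letter hn a x = 0 := by
  have h12 := i1_ne_i2 hn
  have hmem : i1 hn ∈ Finset.univ.erase (i2 hn) := by simp [h12]
  have h : ∑ a ∈ (Finset.univ.erase (i2 hn)).erase (i1 hn), letter hn a x = preSum hn x := by
    rw [preSum, LinearMap.sum_apply, ← Finset.add_sum_erase _ _ hmem, pre_i1,
      LinearMap.zero_apply, zero_add]
    refine Finset.sum_congr rfl fun b hb => ?_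
    simp only [Finset.mem_erase, Finset.mem_univ, and_true] at hb
    rw [letter, if_neg hb.1, if_neg hb.2]
  rw [← Finset.add_sum_erase _ _ (Finset.mem_univ (i2 hn)), ← Finset.add_sum_erase _ _ hmem, h]
  simp [letter, h12.symm, letterSum]

lemma letter_of_normal {a : Fin n} {w : List (Fin n)} (h : IsNormal hn (a :: w)) :
    letter hn a (Finsupp.single w 1) = Finsupp.single (a :: w) 1 := by
  rw [letter, if_neg h.1]
  split_ifs with h2
  · subst h2
    exact letterTwo_of_normal hn h
  · exact pre_of_normal hn h

/-- Extension to `R_{k+1}` of a map on `R_k` to combinations of words, so that it intertwines `e_a`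
with `letter a`. -/
def liftLetters (k : ℕ) (φ : (stage hn k).X →ₗ[ℂ] (List (Fin n) →₀ ℂ))
    (h : ∀ a x, letter hn a (φ (p hn k a x)) = letter hn a (φ x)) :
    (stage hn (k + 1)).X →ₗ[ℂ] (List (Fin n) →₀ ℂ) :=
  (stage hn k).lift (fun a => letter hn a ∘ₗ φ) (fun _ => sum_letter hn _) h

lemma liftLetters_raise (k : ℕ) (φ : (stage hn k).X →ₗ[ℂ] (List (Fin n) →₀ ℂ))
    (h : ∀ a x, letter hn a (φ (p hn k a x)) = letter hn a (φ x)) (a : Fin n)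
    (x : (stage hn k).X) : liftLetters hn k φ h (raise hn k a x) = letter hn a (φ x) :=
  Stage.lift_raise _ _ (fun _ => sum_letter hn _) h a x

lemma letter_liftLetters_p (k : ℕ) (φ : (stage hn k).X →ₗ[ℂ] (List (Fin n) →₀ ℂ))
    (h : ∀ a x, letter hn a (φ (p hn k a x)) = letter hn a (φ x)) (a : Fin n)
    (x : (stage hn (k + 1)).X) :
    letter hn a (liftLetters hn k φ h (p hn (k + 1) a x)) =
      letter hn a (liftLetters hn k φ h x) := by
  rw [p_succ, LinearMap.sub_apply, LinearMap.id_apply, LinearMap.comp_apply, map_sub, map_sub,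
    liftLetters_raise, letter_letter, sub_zero]

/-- The maps `toWords k`, with the property that allows the recursion to continue. -/
def toWordsAux : (k : ℕ) → {φ : (stage hn k).X →ₗ[ℂ] (List (Fin n) →₀ ℂ) //
    ∀ a x, letter hn a (φ (p hn k a x)) = letter hn a (φ x)}
  | 0 => ⟨LinearMap.toSpanSingleton ℂ _ (Finsupp.single [] 1), fun _ _ => rfl⟩
  | k + 1 => ⟨liftLetters hn k (toWordsAux k).1 (toWordsAux k).2,
      letter_liftLetters_p hn k (toWordsAux k).1 (toWordsAux k).2⟩

/-- The map `R_k → ℂ[words]` which intertwines `e_a` with `letter a` and takes `1` to the empty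
word. -/
def toWords (k : ℕ) : (stage hn k).X →ₗ[ℂ] (List (Fin n) →₀ ℂ) := (toWordsAux hn k).1

lemma toWords_raise (k : ℕ) (a : Fin n) (x : (stage hn k).X) :
    toWords hn (k + 1) (raise hn k a x) = letter hn a (toWords hn k x) :=
  liftLetters_raise hn k _ (toWordsAux hn k).2 a x

lemma toWords_zero_one : toWords hn 0 (1 : ℂ) = Finsupp.single [] 1 :=
  one_smul ℂ _

end NormalWords

/-! ### The leading monomials of the Gröbner basis -/

section LeadingMonomials

variable {n : ℕ} (hn : 4 ≤ n)

/-- A word of two symbols with row and column indices different from `1` is a leading monomial. -/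
def IsLMPair (a b : Fin n × Fin n) : Prop :=
  a.1 = b.1 ∨ a.2 = b.2 ∨ (a.2 = i2 hn ∧ b.2 = i3 hn) ∨ (a.1 = i2 hn ∧ b.1 = i3 hn)

/-- The index triples of the relations of degree three: normal words of length three, and `243`. -/
def IsAdmissible (k j i : Fin n) : Prop :=
  k ≠ i1 hn ∧ j ≠ i1 hn ∧ i ≠ i1 hn ∧ k ≠ j ∧ j ≠ i ∧ ¬(k = i2 hn ∧ j = i3 hn) ∧
    ¬(j = i2 hn ∧ i = i3 hn)

/-- The words that are leading monomials of elements of `G_n`. -/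
def IsLM : List (Fin n × Fin n) → Prop
  | [a] => a.1 = i1 hn ∨ a.2 = i1 hn
  | [a, b] => a.1 ≠ i1 hn ∧ a.2 ≠ i1 hn ∧ b.1 ≠ i1 hn ∧ b.2 ≠ i1 hn ∧ IsLMPair hn a b
  | [a, b, c] =>
    (a.2 = i2 hn ∧ b.2 = i4 hn ∧ c.2 = i3 hn ∧ IsAdmissible hn a.1 b.1 c.1) ∨
      (a.1 = i2 hn ∧ b.1 = i4 hn ∧ c.1 = i3 hn ∧ IsAdmissible hn a.2 b.2 c.2)
  | _ => False

open Classical in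
/-- The element of `G_n` with a given leading monomial. The leading monomials of `rinj_{23}` and
`rwel_{23}` coincide, as do those of `bgInj` and `bgWel` at `(2, 4, 3)`; the element that belongs to
`G_n` is chosen. -/
def poly : List (Fin n × Fin n) → Alg n
  | [a] => if a.1 = i1 hn then cs a.2 else rs a.1
  | [a, b] =>
    if a.1 = b.1 then if a.2 = b.2 then ip a.1 a.2 else wel a.1 a.2 b.2
    else if a.2 = b.2 then inj a.1 a.2 b.1
    else if a.2 = i2 hn ∧ b.2 = i3 hn then rinj hn a.1 b.1
    else rwel hn a.2 b.2
  | [a, b, c] =>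
    if a.2 = i2 hn ∧ b.2 = i4 hn ∧ c.2 = i3 hn then bgInj hn a.1 b.1 c.1
    else bgWel hn a.2 b.2 c.2
  | _ => 0

lemma setG_eq : setG hn = poly hn '' {l | IsLM hn l} := by
  have h12 := i1_ne_i2 hn
  have h13 := i1_ne_i3 hn
  have h14 := i1_ne_i4 hn
  have h23 := i2_ne_i3 hn
  have h24 := i2_ne_i4 hn
  have h34 := i3_ne_i4 hn
  ext f
  constructor
  · simp only [setG, setF, setBInj, setBWel, Set.mem_union, Set.mem_ofPred_eq,
      Set.mem_singleton_iff]
    rintro ((((((((((rfl | ⟨i, hi, rfl⟩) | ⟨i, hi, rfl⟩) | ⟨i, j, hi, hj, rfl⟩) |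
      ⟨i, j, k, hi, hj, hk, hik, rfl⟩) | ⟨i, j, k, hi, hj, hk, hjk, rfl⟩) |
      ⟨k, j, hk, hj, hkj, rfl⟩) | ⟨k, j, hk, hj, hkj, h, rfl⟩) |
      ⟨k, j, i, hk, hj, hi, hkj, hji, h, h', rfl⟩) |
      ⟨k, j, i, hk, hj, hi, hkj, hji, h, h', h'', rfl⟩))
    · exact ⟨[(i1 hn, i1 hn)], by simp [IsLM], by simp [poly]⟩
    · exact ⟨[(i1 hn, i)], by simp [IsLM], by simp [poly]⟩
    · exact ⟨[(i, i1 hn)], by simp [IsLM], by simp [poly, hi]⟩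
    · exact ⟨[(i, j), (i, j)], by simp [IsLM, IsLMPair, hi, hj], by simp [poly]⟩
    · exact ⟨[(i, j), (k, j)], by simp [IsLM, IsLMPair, hi, hj, hk], by simp [poly, hik]⟩
    · exact ⟨[(i, j), (i, k)], by simp [IsLM, IsLMPair, hi, hj, hk], by simp [poly, hjk]⟩
    · exact ⟨[(k, i2 hn), (j, i3 hn)], by simp [IsLM, IsLMPair, hj, hk, h12.symm, h13.symm],
        by simp [poly, hkj, h23]⟩
    · exact ⟨[(i2 hn, k), (i3 hn, j)], by simp [IsLM, IsLMPair, hj, hk, h12.symm, h13.symm], by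
        simp only [ne_eq, Prod.mk.injEq] at h
        simp [poly, hkj, h23, h]⟩
    · simp only [ne_eq, Prod.mk.injEq] at h h'
      exact ⟨[(k, i2 hn), (j, i4 hn), (i, i3 hn)], Or.inl ⟨rfl, rfl, rfl, hk, hj, hi, hkj, hji,
        h, h'⟩, by simp [poly]⟩
    · simp only [ne_eq, Prod.mk.injEq] at h h' h''
      exact ⟨[(i2 hn, k), (i4 hn, j), (i3 hn, i)], Or.inr ⟨rfl, rfl, rfl, hk, hj, hi, hkj, hji,
        h, h'⟩, by simp [poly, h'']⟩
  · rintro ⟨l, hl, rfl⟩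
    match l, hl with
    | [(i, j)], hl =>
      refine Or.inl (Or.inl ?_)
      simp only [poly]
      split_ifs with hi
      · by_cases hj : j = i1 hn
        · subst hj
          exact Or.inl (Or.inl (Or.inl (Or.inl (Or.inl (Or.inl (Or.inl rfl))))))
        · exact Or.inl (Or.inl (Or.inl (Or.inl (Or.inl (Or.inl (Or.inr ⟨j, hj, rfl⟩))))))
      · exact Or.inl (Or.inl (Or.inl (Or.inl (Or.inl (Or.inr ⟨i, hi, rfl⟩)))))
    | [(i, j), (k, l)], ⟨hi, hj, hk, hl, h⟩ =>
      refine Or.inl (Or.inl ?_)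
      simp only [poly]
      split_ifs with h1 h2 h2 h3
      · exact Or.inl (Or.inl (Or.inl (Or.inl (Or.inr ⟨i, j, hi, hj, rfl⟩))))
      · exact Or.inl (Or.inl (Or.inr ⟨i, j, l, hi, hj, hl, h2, rfl⟩))
      · exact Or.inl (Or.inl (Or.inl (Or.inr ⟨i, j, k, hi, hj, hk, h1, rfl⟩)))
      · exact Or.inl (Or.inr ⟨i, k, hi, hk, h1, rfl⟩)
      · refine Or.inr ⟨j, l, hj, hl, h2, ?_, rfl⟩
        simpa using h3
    | [(i, j), (k, l), (p, q)], hl =>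
      simp only [poly]
      split_ifs with h1
      · have had : IsAdmissible hn i k p := by
          rcases hl with hl | ⟨rfl, rfl, rfl, -⟩
          · exact hl.2.2.2
          · simp [IsAdmissible, h12.symm, h13.symm, h14.symm, h24, h34.symm, h24.symm]
        obtain ⟨hk, hj, hi, hkj, hji, h, h'⟩ := had
        exact Or.inl (Or.inr ⟨i, k, p, hk, hj, hi, hkj, hji, by simpa using h, by simpa using h',
          rfl⟩)
      · obtain ⟨-, -, -, hk, hj, hi, hkj, hji, h, h'⟩ := hl.resolve_left fun hl => h1
          ⟨hl.1, hl.2.1, hl.2.2.1⟩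
        exact Or.inr ⟨j, l, q, hk, hj, hi, hkj, hji, by simpa using h, by simpa using h',
          by simpa using h1, rfl⟩

lemma not_isLMPair {a b : Fin n × Fin n} : ¬IsLMPair hn a b ↔ (a.1 ≠ b.1 ∧ a.2 ≠ b.2) ∧
    ¬(a.2 = i2 hn ∧ b.2 = i3 hn) ∧ ¬(a.1 = i2 hn ∧ b.1 = i3 hn) := by
  simp only [IsLMPair, not_or]
  tauto

/-- A word whose row word or column word is not normal is divisible by a leading monomial of
`G_n`. -/
lemma exists_isLM_infix (l : List (Fin n × Fin n))
    (hl : ¬(IsNormal hn (l.map Prod.fst) ∧ IsNormal hn (l.map Prod.snd))) :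
    ∃ l', IsLM hn l' ∧ l' <:+: l := by
  induction l with
  | nil => simp [IsNormal] at hl
  | cons a l ih =>
    by_cases h : IsNormal hn (l.map Prod.fst) ∧ IsNormal hn (l.map Prod.snd)
    swap
    · obtain ⟨l', h1, h2⟩ := ih h
      exact ⟨l', h1, h2.trans (List.suffix_cons a l).isInfix⟩
    by_cases ha : a.1 = i1 hn ∨ a.2 = i1 hn
    · exact ⟨[a], ha, [], l, rfl⟩
    push Not at ha
    match l, h with
    | [], h => simp [IsNormal, CanPrepend, ha] at hl
    | b :: l, ⟨hr, hc⟩ =>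
      have hb1 : b.1 ≠ i1 hn := hr.1
      have hb2 : b.2 ≠ i1 hn := hc.1
      by_cases hab : IsLMPair hn a b
      · exact ⟨[a, b], ⟨ha.1, ha.2, hb1, hb2, hab⟩, [], l, rfl⟩
      match l, hr, hc with
      | [], hr, hc =>
        rw [not_isLMPair] at hab
        exact absurd ⟨⟨ha.1, ⟨hab.1.1, hab.2.2, by simp⟩, hr⟩, ⟨ha.2, ⟨hab.1.2, hab.2.1, by simp⟩,
          hc⟩⟩ hl
      | c :: l, hr, hc =>
        have hc1 : c.1 ≠ i1 hn := hr.2.2.1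
        have hc2 : c.2 ≠ i1 hn := hc.2.2.1
        by_cases hbc : IsLMPair hn b c
        · exact ⟨[b, c], ⟨hb1, hb2, hc1, hc2, hbc⟩, [a], l, rfl⟩
        refine ⟨[a, b, c], ?_, [], l, rfl⟩
        rw [not_isLMPair] at hab hbc
        have h1 : IsAdmissible hn a.1 b.1 c.1 :=
          ⟨ha.1, hb1, hc1, hab.1.1, hbc.1.1, hab.2.2, hbc.2.2⟩
        have h2 : IsAdmissible hn a.2 b.2 c.2 :=
          ⟨ha.2, hb2, hc2, hab.1.2, hbc.1.2, hab.2.1, hbc.2.1⟩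
        by_contra hlm
        simp only [IsLM, h1, h2, and_true, not_or] at hlm
        refine hl ⟨⟨ha.1, ⟨hab.1.1, hab.2.2, ?_⟩, hr⟩, ⟨ha.2, ⟨hab.1.2, hab.2.1, ?_⟩, hc⟩⟩
        · simpa using hlm.2
        · simpa using hlm.1

lemma mem_filter_i3 : i3 hn ∈ Finset.univ.filter (i3 hn ≤ ·) := by simp

lemma mem_filter_i4 : i4 hn ∈ (Finset.univ.filter (i3 hn ≤ ·)).erase (i3 hn) := by
  simp [(i3_ne_i4 hn).symm]; simp [i3, i4]

lemma sum_eq_filter_add {M : Type*} [AddCommMonoid M] (f : Fin n → M) :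
    ∑ a, f a = f (i1 hn) + (f (i2 hn) + ∑ a with i3 hn ≤ a, f a) := by
  rw [← Finset.add_sum_erase _ _ (Finset.mem_univ (i1 hn)),
    ← Finset.add_sum_erase _ _ (show i2 hn ∈ Finset.univ.erase (i1 hn) by simp [i1, i2])]
  congr 2
  refine Finset.sum_congr ?_ fun _ _ => rfl
  ext a
  simp only [Finset.mem_erase, Finset.mem_filter, Finset.mem_univ, and_true, true_and, i1, i2, i3,
    Fin.le_def, ne_eq, Fin.ext_iff]
  omega

lemma rs_mem (i : Fin n) : (rs i : Alg n) ∈ idealI n :=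
  TwoSidedIdeal.subset_span (Or.inl (Or.inl (Or.inl (Or.inl ⟨i, rfl⟩))))
lemma cs_mem (i : Fin n) : (cs i : Alg n) ∈ idealI n :=
  TwoSidedIdeal.subset_span (Or.inl (Or.inl (Or.inl (Or.inr ⟨i, rfl⟩))))
lemma ip_mem (i j : Fin n) : (ip i j : Alg n) ∈ idealI n :=
  TwoSidedIdeal.subset_span (Or.inl (Or.inl (Or.inr ⟨i, j, rfl⟩)))
lemma inj_mem {j k : Fin n} (i : Fin n) (h : j ≠ k) : (inj j i k : Alg n) ∈ idealI n :=
  TwoSidedIdeal.subset_span (Or.inl (Or.inr ⟨_, _, _, h, rfl⟩))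
lemma wel_mem {j k : Fin n} (i : Fin n) (h : j ≠ k) : (wel i j k : Alg n) ∈ idealI n :=
  TwoSidedIdeal.subset_span (Or.inr ⟨_, _, _, h, rfl⟩)

lemma rinj_mem {j k : Fin n} (h : j ≠ k) : rinj hn j k ∈ idealI n := by
  have key : rinj hn j k = u j (i2 hn) * rs k - rs j * u k (i1 hn) - inj j (i2 hn) k +
      inj j (i1 hn) k := by
    simp only [rs, sum_eq_filter_add hn, rinj, inj, ← Finset.mul_sum, ← Finset.sum_mul]
    noncomm_ring
  rw [key]
  exact add_mem (sub_mem (sub_mem (TwoSidedIdeal.mul_mem_left _ _ _ (rs_mem k))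
    (TwoSidedIdeal.mul_mem_right _ _ _ (rs_mem j))) (inj_mem _ h)) (inj_mem _ h)

lemma rwel_mem {j k : Fin n} (h : j ≠ k) : rwel hn j k ∈ idealI n := by
  have key : rwel hn j k = u (i2 hn) j * cs k - cs j * u (i1 hn) k - wel (i2 hn) j k +
      wel (i1 hn) j k := by
    simp only [cs, sum_eq_filter_add hn, rwel, wel, ← Finset.mul_sum, ← Finset.sum_mul]
    noncomm_ring
  rw [key]
  exact add_mem (sub_mem (sub_mem (TwoSidedIdeal.mul_mem_left _ _ _ (cs_mem k))
    (TwoSidedIdeal.mul_mem_right _ _ _ (cs_mem j))) (wel_mem _ h)) (wel_mem _ h)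

lemma setG_subset_idealI {g : Alg n} (hg : g ∈ setG hn) : g ∈ idealI n := by
  rcases hg with ((((((((((rfl | ⟨i, -, rfl⟩) | ⟨i, -, rfl⟩) | ⟨i, j, -, -, rfl⟩) |
      ⟨i, j, k, -, -, -, h, rfl⟩) | ⟨i, j, k, -, -, -, h, rfl⟩) |
      ⟨k, j, -, -, h, rfl⟩) | ⟨k, j, -, -, h, -, rfl⟩) |
      ⟨k, j, i, -, -, -, h, h', -, -, rfl⟩) |
      ⟨k, j, i, -, -, -, h, h', -, -, -, rfl⟩))
  · exact cs_mem _
  · exact cs_mem _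
  · exact rs_mem _
  · exact ip_mem _ _
  · exact inj_mem _ h
  · exact wel_mem _ h
  · exact rinj_mem hn h
  · exact rwel_mem hn h
  · exact sub_mem (TwoSidedIdeal.mul_mem_right _ _ _ (rinj_mem hn h))
      (TwoSidedIdeal.mul_mem_left _ _ _ (inj_mem _ h'))
  · exact sub_mem (TwoSidedIdeal.mul_mem_right _ _ _ (rwel_mem hn h))
      (TwoSidedIdeal.mul_mem_left _ _ _ (wel_mem _ h'))

lemma u_mul_u (i j k l : Fin n) : u i j * u k l = mon [(i, j), (k, l)] := by
  simp [mon_cons]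

lemma mon_mem_below_pair {a b a' b' : Fin n × Fin n} (h : varLT a a' ∨ a = a' ∧ varLT b b') :
    mon [a, b] ∈ below [a', b'] := by
  rcases h with h | ⟨rfl, h⟩
  · exact mon_mem_below (.of_lex rfl (.rel h))
  · exact mon_mem_below (.of_lex rfl (.cons (.rel h)))

/-- `rinj_{jk}` without its leading term `u_{j2} u_{k3}`. -/
def rinjTail (j k : Fin n) : Alg n :=
  (∑ α ∈ ({α : Fin n | i3 hn ≤ α} : Finset (Fin n)).erase (i3 hn), u j (i2 hn) * u k α)
    - (∑ α : Fin n with i3 hn ≤ α, u j α * u k (i1 hn))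
    + u k (i1 hn) - u j (i2 hn)

/-- `rwel_{jk}` without its leading term `u_{2j} u_{3k}`. -/
def rwelTail (j k : Fin n) : Alg n :=
  (∑ α ∈ ({α : Fin n | i3 hn ≤ α} : Finset (Fin n)).erase (i3 hn), u (i2 hn) j * u α k)
    - (∑ α : Fin n with i3 hn ≤ α, u α j * u (i1 hn) k)
    + u (i1 hn) k - u (i2 hn) j

lemma rinj_eq (j k : Fin n) : rinj hn j k = u j (i2 hn) * u k (i3 hn) + rinjTail hn j k := by
  rw [rinj, rinjTail, ← Finset.add_sum_erase _ _ (mem_filter_i3 hn)]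
  abel

lemma rwel_eq (j k : Fin n) : rwel hn j k = u (i2 hn) j * u (i3 hn) k + rwelTail hn j k := by
  rw [rwel, rwelTail, ← Finset.add_sum_erase _ _ (mem_filter_i3 hn)]
  abel

/-- If the first sum of `rinj_{jk}` is restricted to terms `u_{j2} u_{kα}` with `u_{kα}` smaller
than `b`, then all monomials are smaller than `u_{j2} b`. With `b = u_{k3}` and `b = u_{k4}` this
gives the leading monomials of `rinj` and of `rinjTail`. -/
lemma rinj_rest_mem_below (j k : Fin n) (b : Fin n × Fin n) (s : Finset (Fin n))
    (hs : ∀ α ∈ s, varLT (k, α) b) :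
    (∑ α ∈ s, u j (i2 hn) * u k α) - (∑ α : Fin n with i3 hn ≤ α, u j α * u k (i1 hn))
    + u k (i1 hn) - u j (i2 hn) ∈ below [(j, i2 hn), b] := by
  simp only [u_mul_u]
  simp only [u_eq_mon]
  refine sub_mem (add_mem (sub_mem (sum_mem fun α hα => ?_) (sum_mem fun α hα => ?_)) ?_) ?_
  · exact mon_mem_below_pair (.inr ⟨rfl, hs α hα⟩)
  · refine mon_mem_below_pair (.inl (.inr ⟨rfl, ?_⟩))
    simp only [Finset.mem_filter, i2, i3, Fin.le_def, Fin.lt_def] at hα ⊢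
    omega
  · exact mon_mem_below_of_length (by simp)
  · exact mon_mem_below_of_length (by simp)

/-- The transpose of `rinj_rest_mem_below`. -/
lemma rwel_rest_mem_below (j k : Fin n) (b : Fin n × Fin n) (s : Finset (Fin n))
    (hs : ∀ α ∈ s, varLT (α, k) b) :
    (∑ α ∈ s, u (i2 hn) j * u α k) - (∑ α : Fin n with i3 hn ≤ α, u α j * u (i1 hn) k)
    + u (i1 hn) k - u (i2 hn) j ∈ below [(i2 hn, j), b] := by
  simp only [u_mul_u]
  simp only [u_eq_mon]
  refine sub_mem (add_mem (sub_mem (sum_mem fun α hα => ?_) (sum_mem fun α hα => ?_)) ?_) ?_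
  · exact mon_mem_below_pair (.inr ⟨rfl, hs α hα⟩)
  · refine mon_mem_below_pair (.inl (.inl ?_))
    simp only [Finset.mem_filter, i2, i3, Fin.le_def, Fin.lt_def] at hα ⊢
    omega
  · exact mon_mem_below_of_length (by simp)
  · exact mon_mem_below_of_length (by simp)

lemma rinjTail_mem_below (j k : Fin n) : rinjTail hn j k ∈ below [(j, i2 hn), (k, i3 hn)] := by
  refine rinj_rest_mem_below hn j k _ _ fun α hα => .inr ⟨rfl, ?_⟩
  simp only [Finset.mem_erase, Finset.mem_filter] at hα
  exact lt_of_le_of_ne hα.2.2 (Ne.symm hα.1)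

lemma rwelTail_mem_below (j k : Fin n) : rwelTail hn j k ∈ below [(i2 hn, j), (i3 hn, k)] := by
  refine rwel_rest_mem_below hn j k _ _ fun α hα => .inl ?_
  simp only [Finset.mem_erase, Finset.mem_filter] at hα
  exact lt_of_le_of_ne hα.2.2 (Ne.symm hα.1)

lemma i4_lt {α : Fin n}
    (hα : α ∈ (({α : Fin n | i3 hn ≤ α} : Finset (Fin n)).erase (i3 hn)).erase (i4 hn)) :
    i4 hn < α := by
  simp only [Finset.mem_erase, Finset.mem_filter, i3, i4, Fin.le_def, Fin.lt_def, ne_eq,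
    Fin.ext_iff] at hα ⊢
  omega

lemma rinjTail_sub_mem_below (j k : Fin n) :
    rinjTail hn j k - mon [(j, i2 hn), (k, i4 hn)] ∈ below [(j, i2 hn), (k, i4 hn)] := by
  have h := rinj_rest_mem_below hn j k (k, i4 hn) _ fun α hα => .inr ⟨rfl, i4_lt hn hα⟩
  convert h using 1
  rw [rinjTail, ← Finset.add_sum_erase _ _ (mem_filter_i4 hn)]
  simp only [mon_cons, mon_nil, mul_one]
  abel

lemma rwelTail_sub_mem_below (j k : Fin n) :
    rwelTail hn j k - mon [(i2 hn, j), (i4 hn, k)] ∈ below [(i2 hn, j), (i4 hn, k)] := by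
  have h := rwel_rest_mem_below hn j k (i4 hn, k) _ fun α hα => .inl (i4_lt hn hα)
  convert h using 1
  rw [rwelTail, ← Finset.add_sum_erase _ _ (mem_filter_i4 hn)]
  simp only [mon_cons, mon_nil, mul_one]
  abel

lemma cs_sub_mem_below (i : Fin n) : cs i - mon [(i1 hn, i)] ∈ below [(i1 hn, i)] := by
  rw [cs, ← Finset.add_sum_erase _ _ (Finset.mem_univ (i1 hn)), u_eq_mon, ← mon_nil, add_sub_assoc,
    add_sub_cancel_left]
  refine sub_mem (sum_mem fun α hα => ?_) (mon_mem_below_of_length (by simp))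
  rw [u_eq_mon]
  refine mon_mem_below (.of_lex rfl (.rel (.inl ?_)))
  simp only [Finset.mem_erase, i1, Fin.lt_def, ne_eq, Fin.ext_iff] at hα ⊢
  omega

lemma rs_sub_mem_below (i : Fin n) : rs i - mon [(i, i1 hn)] ∈ below [(i, i1 hn)] := by
  rw [rs, ← Finset.add_sum_erase _ _ (Finset.mem_univ (i1 hn)), u_eq_mon, ← mon_nil, add_sub_assoc,
    add_sub_cancel_left]
  refine sub_mem (sum_mem fun α hα => ?_) (mon_mem_below_of_length (by simp))
  rw [u_eq_mon]
  refine mon_mem_below (.of_lex rfl (.rel (.inr ⟨rfl, ?_⟩)))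
  simp only [Finset.mem_erase, i1, Fin.lt_def, ne_eq, Fin.ext_iff] at hα ⊢
  omega

lemma poly_sub_mem_below {l : List (Fin n × Fin n)} (hl : IsLM hn l) :
    poly hn l - mon l ∈ below l := by
  match l, hl with
  | [(i, j)], hl =>
    simp only [poly]
    split_ifs with h
    · subst h; exact cs_sub_mem_below hn j
    · obtain rfl : j = i1 hn := hl.resolve_left h
      exact rs_sub_mem_below hn i
  | [(i, j), (k, l)], ⟨_, _, _, _, h⟩ =>
    simp only [poly, mon_cons, mon_nil, mul_one]
    simp only [IsLMPair] at h
    split_ifs with h1 h2 h2 h3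
    · subst h1 h2
      rw [ip, pow_two, sub_sub_cancel_left, u_eq_mon]
      exact neg_mem (mon_mem_below_of_length (by simp))
    · subst h1
      rw [wel, sub_self]
      exact zero_mem _
    · subst h2
      rw [inj, sub_self]
      exact zero_mem _
    · obtain ⟨rfl, rfl⟩ := h3
      rw [rinj_eq, add_sub_cancel_left]
      exact rinjTail_mem_below hn i k
    · obtain ⟨rfl, rfl⟩ : i = i2 hn ∧ k = i3 hn := by tauto
      rw [rwel_eq, add_sub_cancel_left]
      exact rwelTail_mem_below hn j l
  | [(i, j), (k, l), (p, q)], h =>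
    simp only [poly]
    split_ifs with h1
    · obtain ⟨rfl, rfl, rfl⟩ := h1
      have h' := mul_mem_below (rinjTail_sub_mem_below hn i k) [] [(p, i3 hn)]
      have key : bgInj hn i k p - mon [(i, i2 hn), (k, i4 hn), (p, i3 hn)] =
          mon [] * (rinjTail hn i k - mon [(i, i2 hn), (k, i4 hn)]) * mon [(p, i3 hn)] := by
        simp only [bgInj, rinj_eq, inj, mon_cons, mon_nil]
        noncomm_ring
      rwa [key]
    · obtain ⟨rfl, rfl, rfl, -⟩ := h.resolve_left fun h => h1 ⟨h.1, h.2.1, h.2.2.1⟩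
      have h' := mul_mem_below (rwelTail_sub_mem_below hn j l) [] [(i3 hn, q)]
      have key : bgWel hn j l q - mon [(i2 hn, j), (i4 hn, l), (i3 hn, q)] =
          mon [] * (rwelTail hn j l - mon [(i2 hn, j), (i4 hn, l)]) * mon [(i3 hn, q)] := by
        simp only [bgWel, rwel_eq, wel, mon_cons, mon_nil]
        noncomm_ring
      rwa [key]

lemma isLeadingMonomial_poly {l : List (Fin n × Fin n)} (hl : IsLM hn l) :
    IsLeadingMonomial (poly hn l) (FreeMonoid.ofList l) :=
  (isLeadingMonomial_of_sub_mem_below (poly_sub_mem_below hn hl)).1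

lemma isMonic_setG : IsMonic (setG hn) := by
  rw [setG_eq]
  rintro _ ⟨l, hl, rfl⟩
  exact ⟨_, isLeadingMonomial_of_sub_mem_below (poly_sub_mem_below hn hl)⟩

lemma injOn_poly : Set.InjOn (poly hn) {l | IsLM hn l} := by
  intro l hl l' hl' h
  have h' := isLeadingMonomial_poly hn hl'
  rw [← h] at h'
  exact (isLeadingMonomial_poly hn hl).unique h'

lemma IsAdmissible.ne_i1 {k j i : Fin n} (h : IsAdmissible hn k j i) :
    k ≠ i1 hn ∧ j ≠ i1 hn ∧ i ≠ i1 hn := ⟨h.1, h.2.1, h.2.2.1⟩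

lemma isAdmissible_i2_i4_i3 : IsAdmissible hn (i2 hn) (i4 hn) (i3 hn) := by
  simp [IsAdmissible, i1, i2, i3, i4]

lemma IsLM.isAdmissible {a b c : Fin n × Fin n} (h : IsLM hn [a, b, c]) :
    IsAdmissible hn a.1 b.1 c.1 ∧ IsAdmissible hn a.2 b.2 c.2 := by
  rcases h with ⟨h1, h2, h3, h⟩ | ⟨h1, h2, h3, h⟩
  · rw [h1, h2, h3]; exact ⟨h, isAdmissible_i2_i4_i3 hn⟩
  · rw [h1, h2, h3]; exact ⟨isAdmissible_i2_i4_i3 hn, h⟩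

/-- No leading monomial of `G_n` is a proper factor of another one: those of degree one contain an
index `1` and the others do not, and two adjacent symbols of one of degree three never form one of
degree two. -/
lemma eq_of_isLM_of_infix {l l' : List (Fin n × Fin n)} (hl : IsLM hn l) (hl' : IsLM hn l')
    (h : l <:+: l') : l = l' := by
  by_contra hne
  match l', hl', l, hl with
  | [a], _, [b], _ =>
    exact hne (h.eq_of_length rfl)
  | [a, b], _, [c, d], _ => exact hne (h.eq_of_length rfl)
  | [a, b, c], _, [d, e, f], _ => exact hne (h.eq_of_length rfl)
  | [a], _, [b, c], _ => simpa using h.length_le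
  | [a], _, [b, c, d], _ => simpa using h.length_le
  | [a, b], _, [c, d, e], _ => simpa using h.length_le
  | [a, b], h2, [c], h1 =>
    have hc : c ∈ [a, b] := h.subset (by simp)
    simp only [IsLM, List.mem_cons, List.not_mem_nil, or_false] at h1 h2 hc
    rcases hc with rfl | rfl <;> tauto
  | [a, b, c], h2, [d], h1 =>
    have hd : d ∈ [a, b, c] := h.subset (by simp)
    have h3 := h2.isAdmissible.1.ne_i1
    have h4 := h2.isAdmissible.2.ne_i1
    simp only [IsLM, List.mem_cons, List.not_mem_nil, or_false] at h1 hd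
    rcases hd with rfl | rfl | rfl <;> tauto
  | [a, b, c], h2, [d, e], h1 =>
    have h5 : ¬IsLMPair hn a b := by
      obtain ⟨⟨-, -, -, h3, -, h4, -⟩, ⟨-, -, -, h5, -, h6, -⟩⟩ := h2.isAdmissible
      exact (not_isLMPair hn).2 ⟨⟨h3, h5⟩, h6, h4⟩
    have h6 : ¬IsLMPair hn b c := by
      obtain ⟨⟨-, -, -, -, h3, -, h4⟩, ⟨-, -, -, -, h5, -, h6⟩⟩ := h2.isAdmissible
      exact (not_isLMPair hn).2 ⟨⟨h3, h5⟩, h6, h4⟩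
    have h7 : (d = a ∧ e = b) ∨ (d = b ∧ e = c) := by
      simpa [List.infix_cons_iff] using h
    rcases h7 with ⟨rfl, rfl⟩ | ⟨rfl, rfl⟩
    · exact h5 h1.2.2.2.2
    · exact h6 h1.2.2.2.2

lemma isReduced_setG : IsReduced (setG hn) := by
  rw [setG_eq]
  rintro _ ⟨l, hl, rfl⟩ _ ⟨l', hl', rfl⟩ hne v w hv hw ⟨a, b, h⟩
  obtain rfl := hv.unique (isLeadingMonomial_poly hn hl)
  obtain rfl := hw.unique (isLeadingMonomial_poly hn hl')
  exact hne (congrArg _ (eq_of_isLM_of_infix hn hl hl' ⟨a.toList, b.toList, h.symm⟩))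

/-! ### The cardinality -/

lemma card_erase_i1 : ((Finset.univ.erase (i1 hn)).card : ℤ) = n - 1 := by
  rw [Finset.card_erase_of_mem (Finset.mem_univ _), Finset.card_univ, Fintype.card_fin]
  omega

open Classical in
lemma card_filter_isAdmissible :
    (((Finset.univ.filter fun t : Fin n × Fin n × Fin n =>
      IsAdmissible hn t.1 t.2.1 t.2.2).card : ℕ) : ℤ) = (n - 1) * (n - 2) ^ 2 - 2 * (n - 2) := by
  have hE := card_erase_i1 hn
  have h12 := i1_ne_i2 hn
  have h13 := i1_ne_i3 hn
  have h23 := i2_ne_i3 hn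
  set E := Finset.univ.erase (i1 hn) with hEdef
  have m2 : i2 hn ∈ E := by simp [E, h12.symm]
  have m3 : i3 hn ∈ E := by simp [E, h13.symm]
  -- The letters that may precede and follow a given middle letter `j`.
  let before : Fin n → Finset (Fin n) := fun j =>
    if j = i3 hn then (E.erase j).erase (i2 hn) else E.erase j
  let after : Fin n → Finset (Fin n) := fun j =>
    if j = i2 hn then (E.erase j).erase (i3 hn) else E.erase j
  have hbij : (Finset.univ.filter fun t : Fin n × Fin n × Fin n =>
      IsAdmissible hn t.1 t.2.1 t.2.2).card = (E.sigma fun j => before j ×ˢ after j).card := by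
    refine Finset.card_nbij' (fun t => ⟨t.2.1, t.1, t.2.2⟩) (fun s => (s.2.1, s.1, s.2.2))
      ?_ ?_ (fun _ _ => rfl) (fun _ _ => rfl)
    · rintro ⟨k, j, i⟩ h
      obtain ⟨hk, hj, hi, hkj, hji, h, h'⟩ := (Finset.mem_filter.1 h).2
      simp only [Finset.coe_sigma, Set.mem_sigma_iff, Finset.mem_coe, Finset.mem_product, before,
        after, E]
      constructor
      · simpa using hj
      · constructor
        · split_ifs <;> simp <;> tauto
        · split_ifs <;> simp <;> tauto
    · rintro ⟨j, k, i⟩ h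
      simp only [Finset.coe_sigma, Set.mem_sigma_iff, Finset.mem_coe, Finset.mem_product, before,
        after, E] at h
      obtain ⟨h1, h2, h3⟩ := h
      refine Finset.mem_filter.2 ⟨Finset.mem_univ _, ?_⟩
      simp only [IsAdmissible]
      split_ifs at h2 h3 <;> simp at h1 h2 h3 <;> tauto
  have hb : ∀ j ∈ E, ((before j).card : ℤ) = n - 2 - if j = i3 hn then 1 else 0 := by
    intro j hj
    have h1 : ((E.erase j).card : ℤ) = n - 2 := by
      have := Finset.card_erase_add_one hj
      omega
    simp only [before]
    split_ifs with h
    · have := Finset.card_erase_add_one (s := E.erase j) (a := i2 hn) (by simp [m2, h, h23])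
      omega
    · omega
  have ha : ∀ j ∈ E, ((after j).card : ℤ) = n - 2 - if j = i2 hn then 1 else 0 := by
    intro j hj
    have h1 : ((E.erase j).card : ℤ) = n - 2 := by
      have := Finset.card_erase_add_one hj
      omega
    simp only [after]
    split_ifs with h
    · have := Finset.card_erase_add_one (s := E.erase j) (a := i3 hn) (by simp [m3, h, h23.symm])
      omega
    · omega
  rw [hbij, Finset.card_sigma]
  push_cast
  have hsum : ∀ j ∈ E, (((before j ×ˢ after j).card : ℕ) : ℤ) = ((n : ℤ) - 2) ^ 2 -
      (if j = i3 hn then (n : ℤ) - 2 else 0) - (if j = i2 hn then (n : ℤ) - 2 else 0) := by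
    intro j hj
    rw [Finset.card_product]
    push_cast
    rw [hb j hj, ha j hj]
    by_cases h3 : j = i3 hn
    · simp only [h3, h23.symm, if_true, if_false]
      ring
    · simp only [h3, if_false]
      split_ifs <;> ring
  rw [Finset.sum_congr rfl hsum, Finset.sum_sub_distrib, Finset.sum_sub_distrib,
    Finset.sum_ite_eq' E, Finset.sum_ite_eq' E, if_pos m2, if_pos m3, Finset.sum_const,
    nsmul_eq_mul, hE]
  ring

open Classical in
lemma card_filter_letter :
    (((Finset.univ.filter fun a : Fin n × Fin n => a.1 = i1 hn ∨ a.2 = i1 hn).card : ℕ) : ℤ) =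
      2 * n - 1 := by
  have h := Finset.card_filter_add_card_filter_not (s := Finset.univ)
    (fun a : Fin n × Fin n => a.1 = i1 hn ∨ a.2 = i1 hn)
  have h2 : (Finset.univ.filter fun a : Fin n × Fin n => ¬(a.1 = i1 hn ∨ a.2 = i1 hn)) =
      Finset.univ.erase (i1 hn) ×ˢ Finset.univ.erase (i1 hn) := by
    ext a
    simp
  rw [h2, Finset.card_product, Finset.card_univ, Fintype.card_prod, Fintype.card_fin] at h
  have h3 := card_erase_i1 hn
  zify at h
  rw [h3] at h
  linear_combination h

open Classical in
lemma card_filter_pair :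
    (((Finset.univ.filter fun t : (Fin n × Fin n) × (Fin n × Fin n) =>
      IsLM hn [t.1, t.2]).card : ℕ) : ℤ) =
        ((n : ℤ) - 1) ^ 4 - ((n - 1) * (n - 2) - 1) ^ 2 := by
  have h12 := i1_ne_i2 hn
  have h13 := i1_ne_i3 hn
  have h23 := i2_ne_i3 hn
  have hE := card_erase_i1 hn
  set E := Finset.univ.erase (i1 hn) with hEdef
  set Z := (E ×ˢ E) ×ˢ (E ×ˢ E) with hZ
  have h := Finset.card_filter_add_card_filter_not (s := Z) (fun t => IsLMPair hn t.1 t.2)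
  have h1 : (Finset.univ.filter fun t : (Fin n × Fin n) × (Fin n × Fin n) =>
      IsLM hn [t.1, t.2]) = Z.filter (fun t => IsLMPair hn t.1 t.2) := by
    ext t
    rw [Finset.mem_filter, Finset.mem_filter]
    simp [IsLM, Z, E, and_assoc]
  -- A pair avoids the leading monomials of degree two if and only if both its row pair and its
  -- column pair are normal.
  have h2 : (Z.filter (fun t => ¬IsLMPair hn t.1 t.2)).card =
      (E.offDiag.erase (i2 hn, i3 hn) ×ˢ E.offDiag.erase (i2 hn, i3 hn)).card := by
    refine Finset.card_nbij' (fun t => ((t.1.1, t.2.1), (t.1.2, t.2.2)))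
      (fun t => ((t.1.1, t.2.1), (t.1.2, t.2.2))) ?_ ?_ (fun _ _ => rfl) (fun _ _ => rfl)
    · rintro ⟨⟨i, j⟩, ⟨k, l⟩⟩ h
      simp only [not_isLMPair, Finset.coe_filter, Set.mem_ofPred_eq, Z, Finset.mem_product] at h
      simp only [Finset.mem_coe, Finset.mem_product, Finset.mem_erase, Finset.mem_offDiag, ne_eq,
        Prod.mk.injEq]
      tauto
    · rintro ⟨⟨i, k⟩, ⟨j, l⟩⟩ h
      simp only [Finset.mem_coe, Finset.mem_product, Finset.mem_erase, Finset.mem_offDiag, ne_eq,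
        Prod.mk.injEq] at h
      simp only [not_isLMPair, Finset.coe_filter, Set.mem_ofPred_eq, Z, Finset.mem_product]
      tauto
  have h3 : ((E.offDiag.erase (i2 hn, i3 hn)).card : ℤ) = (n - 1) * (n - 2) - 1 := by
    have h4 := Finset.card_erase_add_one (s := E.offDiag) (a := (i2 hn, i3 hn))
      (by simp [E, h12.symm, h13.symm, h23])
    have h5 := Finset.offDiag_card E
    have h6 : E.card ≤ E.card * E.card := Nat.le_mul_self _
    zify [h6] at h4 h5
    rw [hE] at h5
    linear_combination h4 + h5
  rw [h1]
  rw [h2, Finset.card_product] at h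
  zify at h
  rw [h3] at h
  simp only [Z, Finset.card_product] at h
  push_cast at h
  rw [hE] at h
  linear_combination h

open Classical in
lemma card_filter_triple :
    (((Finset.univ.filter fun t : (Fin n × Fin n) × (Fin n × Fin n) × (Fin n × Fin n) =>
      IsLM hn [t.1, t.2.1, t.2.2]).card : ℕ) : ℤ) =
        2 * ((n - 1) * (n - 2) ^ 2 - 2 * (n - 2)) - 1 := by
  have hS := card_filter_isAdmissible hn
  set S := Finset.univ.filter fun t : Fin n × Fin n × Fin n => IsAdmissible hn t.1 t.2.1 t.2.2
  let f : Fin n × Fin n × Fin n → (Fin n × Fin n) × (Fin n × Fin n) × (Fin n × Fin n) :=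
    fun t => ((t.1, i2 hn), (t.2.1, i4 hn), (t.2.2, i3 hn))
  let g : Fin n × Fin n × Fin n → (Fin n × Fin n) × (Fin n × Fin n) × (Fin n × Fin n) :=
    fun t => ((i2 hn, t.1), (i4 hn, t.2.1), (i3 hn, t.2.2))
  have hf : Function.Injective f := by
    rintro ⟨a, b, c⟩ ⟨a', b', c'⟩ h
    simp only [f, Prod.mk.injEq] at h
    simp [h]
  have hg : Function.Injective g := by
    rintro ⟨a, b, c⟩ ⟨a', b', c'⟩ h
    simp only [g, Prod.mk.injEq] at h
    simp [h]
  have h1 : (Finset.univ.filter fun t : (Fin n × Fin n) × (Fin n × Fin n) × (Fin n × Fin n) =>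
      IsLM hn [t.1, t.2.1, t.2.2]) = S.image f ∪ S.image g := by
    ext ⟨⟨i, j⟩, ⟨k, l⟩, ⟨p, q⟩⟩
    simp only [Finset.mem_filter, Finset.mem_univ, true_and, Finset.mem_union,
      Finset.mem_image, S, f, g, Prod.exists, Prod.mk.injEq]
    simp only [IsLM]
    constructor
    · rintro (⟨h1, h2, h3, h⟩ | ⟨h1, h2, h3, h⟩)
      · exact Or.inl ⟨i, k, p, h, by simp [h1, h2, h3]⟩
      · exact Or.inr ⟨j, l, q, h, by simp [h1, h2, h3]⟩
    · rintro (⟨a, b, c, h, ⟨rfl, rfl⟩, ⟨rfl, rfl⟩, rfl, rfl⟩ |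
        ⟨a, b, c, h, ⟨rfl, rfl⟩, ⟨rfl, rfl⟩, rfl, rfl⟩)
      · exact Or.inl ⟨rfl, rfl, rfl, h⟩
      · exact Or.inr ⟨rfl, rfl, rfl, h⟩
  have h2 : S.image f ∩ S.image g =
      {((i2 hn, i2 hn), (i4 hn, i4 hn), (i3 hn, i3 hn))} := by
    have h243 := isAdmissible_i2_i4_i3 hn
    ext ⟨⟨i, j⟩, ⟨k, l⟩, ⟨p, q⟩⟩
    simp only [Finset.mem_inter, Finset.mem_filter, Finset.mem_univ, true_and, Finset.mem_image, S,
      f, g, Prod.exists, Prod.mk.injEq, Finset.mem_singleton]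
    constructor
    · rintro ⟨⟨a, b, c, h, ⟨rfl, rfl⟩, ⟨rfl, rfl⟩, rfl, rfl⟩,
        ⟨a', b', c', h', ⟨rfl, rfl⟩, ⟨rfl, rfl⟩, rfl, rfl⟩⟩
      simp
    · rintro ⟨⟨rfl, rfl⟩, ⟨rfl, rfl⟩, rfl, rfl⟩
      exact ⟨⟨_, _, _, h243, by simp⟩, ⟨_, _, _, h243, by simp⟩⟩
  have h3 := Finset.card_union_add_card_inter (S.image f) (S.image g)
  rw [h2, Finset.card_singleton, Finset.card_image_of_injective _ hf,
    Finset.card_image_of_injective _ hg] at h3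
  rw [h1]
  zify at h3
  linear_combination h3 + 2 * hS

lemma finite_and_ncard_isLM : {l | IsLM hn l}.Finite ∧
    ({l | IsLM hn l}.ncard : ℤ) = 4 * (n : ℤ) ^ 3 - 15 * (n : ℤ) ^ 2 + 16 * (n : ℤ) - 2 := by
  classical
  have c1 := card_filter_letter hn
  have c2 := card_filter_pair hn
  have c3 := card_filter_triple hn
  set F1 := Finset.univ.filter fun a : Fin n × Fin n => a.1 = i1 hn ∨ a.2 = i1 hn
  set F2 := Finset.univ.filter fun t : (Fin n × Fin n) × (Fin n × Fin n) => IsLM hn [t.1, t.2]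
  set F3 := Finset.univ.filter fun t : (Fin n × Fin n) × (Fin n × Fin n) × (Fin n × Fin n) =>
      IsLM hn [t.1, t.2.1, t.2.2]
  have h : {l | IsLM hn l} = ((F1.image fun a => [a]) ∪ (F2.image fun t => [t.1, t.2]) ∪
      F3.image fun t => [t.1, t.2.1, t.2.2] : Finset (List (Fin n × Fin n))) := by
    ext l
    simp only [Finset.coe_union, Finset.coe_image, Set.mem_union, Set.mem_image, Finset.mem_coe,
      F1, F2, F3, Finset.mem_filter, Finset.mem_univ, true_and, Set.mem_ofPred_eq]
    constructor
    · intro h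
      match l, h with
      | [a], h => exact Or.inl (Or.inl ⟨a, h, rfl⟩)
      | [a, b], h => exact Or.inl (Or.inr ⟨(a, b), h, rfl⟩)
      | [a, b, c], h => exact Or.inr ⟨(a, b, c), h, rfl⟩
    · rintro ((⟨a, h, rfl⟩ | ⟨t, h, rfl⟩) | ⟨t, h, rfl⟩) <;> exact h
  refine ⟨h ▸ Finset.finite_toSet _, ?_⟩
  rw [h, Set.ncard_coe_finset, Finset.card_union_of_disjoint, Finset.card_union_of_disjoint,
    Finset.card_image_of_injective, Finset.card_image_of_injective,
    Finset.card_image_of_injective]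
  · push_cast
    rw [c1, c2, c3]
    ring
  · rintro ⟨a, b, c⟩ ⟨a', b', c'⟩ h
    simpa using h
  · rintro ⟨a, b⟩ ⟨a', b'⟩ h
    simpa using h
  · intro a b h
    simpa using h
  · rw [Finset.disjoint_left]
    intro l h1 h2
    obtain ⟨a, -, rfl⟩ := Finset.mem_image.1 h1
    obtain ⟨t, -, h3⟩ := Finset.mem_image.1 h2
    simp at h3
  · rw [Finset.disjoint_left]
    intro l h1 h2
    obtain ⟨t, -, rfl⟩ := Finset.mem_image.1 h2
    rcases Finset.mem_union.1 h1 with h3 | h3 <;> obtain ⟨a, -, h4⟩ := Finset.mem_image.1 h3 <;>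
      simp at h4

end LeadingMonomials

/-! ### Independence of normal words and the Gröbner basis property -/

section Independence

variable {n : ℕ} (hn : 4 ≤ n)

/-- The representation of the free algebra on `Rep` in which `u_{ij}` acts as `magic i j`. -/
def act : Alg n →ₐ[ℂ] Module.End ℂ (Rep hn) := FreeAlgebra.lift ℂ fun a => magic hn a.1 a.2

lemma act_u (i j : Fin n) : act hn (u i j) = magic hn i j := by
  simp [act, u]

lemma act_eq_zero {f : Alg n} (hf : f ∈ idealI n) : act hn f = 0 := by
  rw [← TwoSidedIdeal.mem_ker (f := act hn)]
  refine TwoSidedIdeal.span_le.2 ?_ hf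
  rintro _ ((((⟨i, rfl⟩ | ⟨i, rfl⟩) | ⟨i, j, rfl⟩) | ⟨i, j, k, h, rfl⟩) | ⟨i, j, k, h, rfl⟩) <;>
    rw [SetLike.mem_coe, TwoSidedIdeal.mem_ker]
  · simp [rs, act_u, sum_magic_row]
  · simp [cs, act_u, sum_magic_col]
  · simp [ip, act_u, pow_two, magic_mul_self]
  · simp [inj, act_u, magic_mul_col hn _ h]
  · simp [wel, act_u, magic_mul_row hn _ h]

/-- The vector `1 ⊗ 1` in degree zero. -/
def vacuum : Rep hn := fun k =>
  match k with
  | 0 => (1 : ℂ) ⊗ₜ[ℂ] (1 : ℂ)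
  | _ + 1 => 0

lemma act_mon_apply_of_length_lt (l : List (Fin n × Fin n)) {k : ℕ} (h : l.length < k) :
    act hn (mon l) (vacuum hn) k = 0 := by
  induction l generalizing k with
  | nil =>
    obtain ⟨k, rfl⟩ := Nat.exists_eq_succ_of_ne_zero h.ne'
    simp [vacuum]
  | cons a l ih =>
    obtain ⟨k, rfl⟩ := Nat.exists_eq_succ_of_ne_zero (Nat.ne_zero_of_lt h)
    simp only [List.length_cons, Nat.succ_eq_add_one, add_lt_add_iff_right] at h
    rw [mon_cons, map_mul, act_u, Module.End.mul_apply, magic_apply_succ, ih h, ih (h.trans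
      k.lt_succ_self),
      ih (show l.length < k + 2 by omega)]
    simp

/-- The map `toWords k` on both tensor factors. -/
def toWordsTensor (k : ℕ) : (stage hn k).X ⊗[ℂ] (stage hn k).X →ₗ[ℂ]
    (List (Fin n) →₀ ℂ) ⊗[ℂ] (List (Fin n) →₀ ℂ) :=
  TensorProduct.map (toWords hn k) (toWords hn k)

lemma toWordsTensor_raise (k : ℕ) (i j : Fin n) (x : (stage hn k).X ⊗[ℂ] (stage hn k).X) :
    toWordsTensor hn (k + 1) (TensorProduct.map (raise hn k i) (raise hn k j) x) =
      TensorProduct.map (letter hn i) (letter hn j) (toWordsTensor hn k x) := by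
  have h : ∀ i, toWords hn (k + 1) ∘ₗ raise hn k i = letter hn i ∘ₗ toWords hn k := fun i =>
    LinearMap.ext (toWords_raise hn k i)
  rw [toWordsTensor, toWordsTensor, map_map, map_map, h, h]

/-- The top component of a normal word applied to the vacuum is its row word tensor its column
word. -/
lemma toWordsTensor_act_mon (l : List (Fin n × Fin n))
    (h1 : IsNormal hn (l.map Prod.fst)) (h2 : IsNormal hn (l.map Prod.snd)) {k : ℕ}
    (hk : l.length = k) : toWordsTensor hn k (act hn (mon l) (vacuum hn) k) =
      Finsupp.single (l.map Prod.fst) 1 ⊗ₜ Finsupp.single (l.map Prod.snd) 1 := by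
  subst hk
  induction l with
  | nil =>
    simp only [mon_nil, map_one, Module.End.one_apply, List.length_nil, List.map_nil]
    refine (TensorProduct.map_tmul ..).trans ?_
    rw [toWords_zero_one]
  | cons a l ih =>
    rw [mon_cons, map_mul, act_u, Module.End.mul_apply, List.length_cons, magic_apply_succ,
      act_mon_apply_of_length_lt hn l (show l.length < l.length + 1 by omega),
      act_mon_apply_of_length_lt hn l (show l.length < l.length + 2 by omega)]
    simp only [map_zero, smul_zero, add_zero, zero_add]
    rw [toWordsTensor_raise, ih h1.2.2 h2.2.2, TensorProduct.map_tmul, letter_of_normal hn h1,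
      letter_of_normal hn h2]
    rfl

/-- The functional on the free algebra which reads off, in the component of degree `|l|` of
`f · vacuum`, the coefficient of the row word of `l` tensor the column word of `l`. -/
def normalCoeff (l : List (Fin n × Fin n)) : Alg n →ₗ[ℂ] ℂ :=
  LinearMap.mul' ℂ ℂ ∘ₗ
    TensorProduct.map (Finsupp.lapply (l.map Prod.fst)) (Finsupp.lapply (l.map Prod.snd)) ∘ₗ
    toWordsTensor hn l.length ∘ₗ LinearMap.proj l.length ∘ₗ
    LinearMap.applyₗ (vacuum hn) ∘ₗ (act hn).toLinearMap

lemma normalCoeff_eq_zero {f : Alg n} (hf : f ∈ idealI n) (l : List (Fin n × Fin n)) :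
    normalCoeff hn l f = 0 := by
  simp [normalCoeff, act_eq_zero hn hf]

/-- Both the row word and the column word are normal. -/
def IsNormalWord (l : List (Fin n × Fin n)) : Prop :=
  IsNormal hn (l.map Prod.fst) ∧ IsNormal hn (l.map Prod.snd)

lemma normalCoeff_mon_self {l : List (Fin n × Fin n)} (h : IsNormalWord hn l) :
    normalCoeff hn l (mon l) = 1 := by
  simp [normalCoeff, toWordsTensor_act_mon hn l h.1 h.2 rfl]

lemma normalCoeff_mon_of_shortlex {v l : List (Fin n × Fin n)} (hv : IsNormalWord hn v)
    (h : List.Shortlex varLT v l) : normalCoeff hn l (mon v) = 0 := by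
  classical
  rcases (List.shortlex_def.1 h) with hlen | ⟨hlen, -⟩
  · simp [normalCoeff, act_mon_apply_of_length_lt hn v hlen]
  · have hne : v ≠ l := fun h' => Std.Irrefl.irrefl (r := List.Shortlex varLT) l (h' ▸ h)
    have hne' : ¬(v.map Prod.fst = l.map Prod.fst ∧ v.map Prod.snd = l.map Prod.snd) := by
      rintro ⟨h1, h2⟩
      refine hne ?_
      rw [← List.zip_unzip v, ← List.zip_unzip l, List.unzip_eq_map, List.unzip_eq_map, h1, h2]
    simp only [normalCoeff, LinearMap.comp_apply, LinearMap.proj_apply,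
      AlgHom.toLinearMap_apply, LinearMap.applyₗ_apply_apply,
      toWordsTensor_act_mon hn v hv.1 hv.2 hlen, TensorProduct.map_tmul, LinearMap.mul'_apply,
      Finsupp.lapply_apply, Finsupp.single_apply]
    rw [not_and_or] at hne'
    rcases hne' with h | h <;> simp [h]

/-- The span of the normal monomials smaller than `l`. -/
def normalBelow (l : List (Fin n × Fin n)) : Submodule ℂ (Alg n) :=
  Submodule.span ℂ (mon '' {v | IsNormalWord hn v ∧ List.Shortlex varLT v l})

lemma normalCoeff_of_mem_normalBelow {f : Alg n} {l : List (Fin n × Fin n)}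
    (hf : f ∈ normalBelow hn l) : normalCoeff hn l f = 0 := by
  suffices h : normalBelow hn l ≤ LinearMap.ker (normalCoeff hn l) from h hf
  refine Submodule.span_le.2 ?_
  rintro _ ⟨v, ⟨hv, hvl⟩, rfl⟩
  exact normalCoeff_mon_of_shortlex hn hv hvl

/-- Reduction modulo `I_n`: as the leading terms of `G_n` can be replaced by smaller monomials,
every combination of monomials smaller than `l` is congruent to one of normal monomials smaller than
`l`. -/
lemma exists_sub_mem_of_mem_below (l : List (Fin n × Fin n)) :
    ∀ f ∈ below l, ∃ g ∈ normalBelow hn l, f - g ∈ idealI n := by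
  induction l using (List.Shortlex.wf (wellFounded_varLT (n := n))).induction with
  | _ l ih =>
  intro f hf
  induction hf using Submodule.span_induction with
  | zero => exact ⟨0, zero_mem _, by simp⟩
  | add f f' _ _ h h' =>
    obtain ⟨g, hg, h⟩ := h
    obtain ⟨g', hg', h'⟩ := h'
    refine ⟨g + g', add_mem hg hg', ?_⟩
    rw [add_sub_add_comm]
    exact add_mem h h'
  | smul c f _ h =>
    obtain ⟨g, hg, h⟩ := h
    refine ⟨c • g, Submodule.smul_mem _ _ hg, ?_⟩
    rw [← smul_sub, Algebra.smul_def]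
    exact TwoSidedIdeal.mul_mem_left _ _ _ h
  | mem f hf =>
    obtain ⟨v, hv, rfl⟩ := hf
    by_cases hnv : IsNormalWord hn v
    · exact ⟨mon v, Submodule.subset_span ⟨v, ⟨hnv, hv⟩, rfl⟩, by simp⟩
    obtain ⟨w, hw, a, b, rfl⟩ := exists_isLM_infix hn v hnv
    obtain ⟨g, hg, h⟩ := ih _ hv _ (mul_mem_below (poly_sub_mem_below hn hw) a b)
    have hpoly : poly hn w ∈ idealI n :=
      setG_subset_idealI hn (by rw [setG_eq]; exact ⟨w, hw, rfl⟩)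
    refine ⟨-g, neg_mem (Submodule.span_mono (Set.image_mono ?_) hg), ?_⟩
    · rintro u ⟨hu, hul⟩
      exact ⟨hu, _root_.trans hul hv⟩
    · have key : mon (a ++ w ++ b) - -g = mon a * poly hn w * mon b -
          (mon a * (poly hn w - mon w) * mon b - g) := by
        rw [mon_append, mon_append]; noncomm_ring
      rw [key]
      exact sub_mem (TwoSidedIdeal.mul_mem_right _ _ _ (TwoSidedIdeal.mul_mem_left _ _ _ hpoly)) h

lemma not_isNormalWord_of_isLeadingMonomial {f : Alg n} (hf : f ∈ idealI n) {w : Word n}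
    (hw : IsLeadingMonomial f w) : ¬IsNormalWord hn w.toList := by
  classical
  intro hnw
  have hb : f - coeff f w • mon w.toList ∈ below w.toList := by
    refine mem_of_mon_mem fun v hv => mon_mem_below ?_
    have hc : coeff f v - coeff f w * (if w = v then 1 else 0) ≠ 0 := by
      have := coeff_mon w.toList v
      rw [FreeMonoid.ofList_toList] at this
      rwa [← this, ← coeffLin_apply, ← coeffLin_apply v (mon _), ← smul_eq_mul, ← map_smul,
        ← map_sub]
    by_cases hvw : w = v
    · subst hvw; simp at hc
    · exact hw.2 v (by simpa [hvw] using hc) (Ne.symm hvw)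
  obtain ⟨g, hg, hfg⟩ := exists_sub_mem_of_mem_below hn _ _ hb
  have h := normalCoeff_eq_zero hn (sub_mem hf hfg) w.toList
  have key : f - (f - coeff f w • mon w.toList - g) = coeff f w • mon w.toList + g := by abel
  rw [key, map_add, map_smul, normalCoeff_mon_self hn hnw, normalCoeff_of_mem_normalBelow hn hg,
    add_zero, smul_eq_mul, mul_one] at h
  exact hw.1 h

lemma isGroebnerBasis_setG : IsGroebnerBasis (setG hn) (idealI n) := by
  refine ⟨fun g hg => setG_subset_idealI hn hg, fun f hf hf0 => ?_⟩
  obtain ⟨w, hw⟩ := exists_isLeadingMonomial hf0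
  obtain ⟨l, hl, a, b, hab⟩ := exists_isLM_infix hn w.toList
    (not_isNormalWord_of_isLeadingMonomial hn hf hw)
  refine ⟨poly hn l, by rw [setG_eq]; exact ⟨l, hl, rfl⟩, _, w, isLeadingMonomial_poly hn hl, hw,
    FreeMonoid.ofList a, FreeMonoid.ofList b, ?_⟩
  exact FreeMonoid.toList.injective hab.symm

end Independence

end QuantumSym

end

theorem theorem1p2 (n : ℕ) (hn : 4 ≤ n) :
    QuantumSym.IsGroebnerBasis (QuantumSym.setG hn) (QuantumSym.idealI n) ∧
      (QuantumSym.setG hn).Finite ∧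
      QuantumSym.IsMonic (QuantumSym.setG hn) ∧
      QuantumSym.IsReduced (QuantumSym.setG hn) ∧
      ((QuantumSym.setG hn).ncard : ℤ) = 4 * (n : ℤ) ^ 3 - 15 * (n : ℤ) ^ 2 + 16 * (n : ℤ) - 2 := by
  refine ⟨QuantumSym.isGroebnerBasis_setG hn, ?_, QuantumSym.isMonic_setG hn,
    QuantumSym.isReduced_setG hn, ?_⟩
  · rw [QuantumSym.setG_eq]
    exact (QuantumSym.finite_and_ncard_isLM hn).1.image _
  · rw [QuantumSym.setG_eq, (QuantumSym.injOn_poly hn).ncard_image]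
    exact (QuantumSym.finite_and_ncard_isLM hn).2
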